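/- Setting. Let $H$ be a real Hilbert space with complete orthonormal system $(f_k)_{k\ge 0}$, and let $\mu_0\ge\mu_1\ge\dots\ge 0$ satisfy $\mu_k\sim k^{-2}$, i.e. there are $c_1,c_2>0$ with $\mu_k\le c_2(k+1)^{-2}$ for all $k$ and $\mu_k\ge c_1(k+1)^{-2}$ whenever $\mu_k\ne 0$ (so $\mu_k=0$ from some index on is allowed). Put $\|x\|_{s}=\big(\sum_k\mu_k^{2s}\langle x,f_k\rangle^2\big)^{1/2}\in[0,\infty]$ (with $0^{2s}=\infty$ for $s<0$, $0^0=1$, and $\infty\cdot 0=0$). Let $\lambda>0$ and, for $\eta>0$, let $S_\eta=\big(\mathrm{Id}+\eta\tfrac{\lambda}{2}\nabla\|\cdot\|_{H_K}^2\big)^{-1}$ with $\|x\|_{H_K}^2=\sum_k\langle x,f_k\rangle^2/\mu_k$, i.e. $S_\eta f_k=\frac{\mu_k}{\mu_k+\lambda\eta}f_k$. For $N\in\mathbb N$ let $H_N=\mathrm{span}\{f_0,\dots,f_N\}$, with orthogonal projection $P_N$. Fix constants $M,B\in\mathbb R$, $\alpha\in(1/4,1)$, $C_{\alpha}>0$,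 $\alpha'\in[0,1)$, $C_{\alpha'}>0$. Let $L=\frac1{n_{tr}}\sum_{i=1}^{n_{tr}}\ell_i$ with $n_{tr}\ge 2$, where each $\ell_i:H\to\mathbb R$ is three times Fréchet differentiable and satisfies, for all $x,y,h,k\in H$, - $\|\nabla\ell_i(x)-\nabla\ell_i(y)\|\le M\|x-y\|$ and $\|\nabla\ell_i(x)\|\le B$; - $|D^2\ell_i(x)\cdot(h,k)|\le C_{\alpha}\|h\|\,\|k\|_{\alpha}$; and, for all $N\in\mathbb N$ and $x,h,k\in H_N$, with $\ell_{i,N}=\ell_i\circ P_N$ and $D^3\ell_{i,N}(x)\cdot(h,k)$ identified with its Riesz representer, - $\|D^3\ell_{i,N}(x)\cdot(h,k)\|_{\alpha'}\le C_{\alpha'}\|h\|_0\|k\|_0$ and $\|D^3\ell_{i,N}(x)\cdot(h,k)\|_{0}\le C_{\alpha'}\|h\|_{-\alpha'}\|k\|_0$. Let $\varepsilon_0,\varepsilon_1,\dots$ be i.i.d. cylindrical standard Gaussians, $\varepsilon_n=\sum_k\varepsilon_{n,k}f_k$ with independent $\varepsilon_{n,k}\sim\mathcal N(0,1)$, and,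 independently of them, let $I_0,I_1,\dots$ be i.i.d. uniform among the subsets of $\{1,\dots,n_{tr}\}$ of size $n_b$, where $1\le n_b\le n_{tr}$. For $\beta>0$ define the Galerkin GLD and SGLD iterates by $X_0^N=Y_0^N=P_Nx_0$ and $$X_{n+1}^N=S_\eta\Big(X_n^N-\eta P_N\nabla L(P_NX_n^N)+\sqrt{\tfrac{2\eta}{\beta}}\,P_N\varepsilon_n\Big),\qquad Y_{n+1}^N=S_\eta\Big(Y_n^N-\eta P_N g_n(P_NY_n^N)+\sqrt{\tfrac{2\eta}{\beta}}\,P_N\varepsilon_n\Big),$$ with $g_n(x)=\frac1{n_b}\sum_{i\in I_n}\nabla\ell_i(x)$. Let $$r_n=\frac{n\beta\eta\,(n_{tr}-n_b)}{n_b(n_{tr}-1)}.$$ Proposition. There exist constants $C>0$ and $\eta_0>0$, depending only on $H,(f_k),(\mu_k),\lambda,M,B,\alpha,C_\alpha,\alpha',C_{\alpha'}$, such that for all $n_{tr},n_b,(\ell_i)$ as above, all $x_0$ with $\|x_0\|\le1$, all $n,N\in\mathbb N$, all $\beta>1$ and all $0<\eta<\eta_0$, the following holds (all the random variables $\phi(X_n^N),\phi(Y_n^N),L(X_n^N),L(Y_n^N)$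 below being integrable). 1. For every $\phi\in C_b^2(H)$ (bounded, twice continuously Fréchet differentiable, with bounded first and second derivatives), with $\|\phi\|_{0,2}=\max\{\sup|\phi|,\sup\|\nabla\phi\|,\sup\|D^2\phi\|\}$, $$\big|\mathbb E[\phi(X_n^N)-\phi(Y_n^N)]\big|\le C\,\|\phi\|_{0,2}\big(\sqrt{r_n}+\sqrt[4]{r_n}\big).$$ 2. For every global minimizer $x^*$ of $L$ and $\phi(x)=\sigma(L(x)-L(x^*))$, $\sigma(u)=\frac1{1+e^{-u}}-\frac12$, $$\big|\mathbb E[\phi(X_n^N)-\phi(Y_n^N)]\big|\le C\big(\sqrt{r_n}+\sqrt[4]{r_n}\big).$$ 3. For the objective itself, $$\big|\mathbb E[L(X_n^N)-L(Y_n^N)]\big|\le C\big(\sqrt{r_n}+\sqrt[4]{r_n}\big).$$ -/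

import Mathlib

open MeasureTheory ProbabilityTheory
open scoped ENNReal RealInnerProductSpace Gradient

noncomputable section

namespace SGLD

section Spectral

variable {H : Type*} [NormedAddCommGroup H] [InnerProductSpace ℝ H]

/-- The eigenvalues `μ 0 ≥ μ 1 ≥ ⋯ ≥ 0` satisfy `μ k ∼ 1 / k ^ 2` (two-sided bounds up to
constants, the index being shifted because it starts at `0`).  Vanishing eigenvalues from some
index on are allowed (finite-dimensional situation). -/
def EigenvalueDecay (μ : ℕ → ℝ) : Prop :=
  Antitone μ ∧ (∀ k, 0 ≤ μ k) ∧
    ∃ c₁ : ℝ, 0 < c₁ ∧ ∃ c₂ : ℝ, 0 < c₂ ∧ ∀ k : ℕ,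
      μ k ≤ c₂ / ((k : ℝ) + 1) ^ 2 ∧ (μ k ≠ 0 → c₁ / ((k : ℝ) + 1) ^ 2 ≤ μ k)

/-- The weighted norm `‖x‖_s = (∑ₖ μₖ ^ (2 s) ⟨x, fₖ⟩²) ^ (1 / 2)`, with values in `[0, ∞]`. -/
def weightedNorm (f : HilbertBasis ℕ ℝ H) (μ : ℕ → ℝ) (s : ℝ) (x : H) : ℝ≥0∞ :=
  (∑' k : ℕ, ENNReal.ofReal (μ k) ^ (2 * s) * ENNReal.ofReal (⟪f k, x⟫ ^ 2)) ^ (1 / 2 : ℝ)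

/-- `H_N = span {f₀, …, f_N}`. -/
def galerkinSpace (f : HilbertBasis ℕ ℝ H) (N : ℕ) : Submodule ℝ H :=
  Submodule.span ℝ ((fun k : ℕ => f k) '' Set.Iic N)

/-- The orthogonal projection `P_N` onto `H_N`. -/
def galerkinProj (f : HilbertBasis ℕ ℝ H) (N : ℕ) (x : H) : H :=
  ∑ k ∈ Finset.range (N + 1), ⟪f k, x⟫ • f k

/-- `S_η = (Id + η (λ / 2) ∇ ‖·‖²_{H_K})⁻¹`, where `‖x‖²_{H_K} = ∑ₖ ⟨x, fₖ⟩² / μₖ`.  It is diagonal: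
`S_η fₖ = (1 + λ η / μₖ)⁻¹ fₖ`, written so that `S_η fₖ = 0` when `μₖ = 0`. -/
def resolventS (f : HilbertBasis ℕ ℝ H) (μ : ℕ → ℝ) (lam η : ℝ) (x : H) : H :=
  ∑' k : ℕ, (μ k / (μ k + lam * η) * ⟪f k, x⟫) • f k

end Spectral

section Loss

variable {H : Type*} [NormedAddCommGroup H] [InnerProductSpace ℝ H] [CompleteSpace H]

/-- The gradient of `l` is `M`-Lipschitz. -/
def IsSmoothWith (M : ℝ) (l : H → ℝ) : Prop :=
  Differentiable ℝ l ∧ ∀ x y : H, ‖∇ l x - ∇ l y‖ ≤ M * ‖x - y‖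

/-- The gradient of `l` is bounded by `B`. -/
def HasBoundedGradient (B : ℝ) (l : H → ℝ) : Prop :=
  ∀ x : H, ‖∇ l x‖ ≤ B

/-- `|D² l(x) · (h, k)| ≤ C ‖h‖ ‖k‖_α` for all `x, h, k`. -/
def SecondDerivBound (f : HilbertBasis ℕ ℝ H) (μ : ℕ → ℝ) (α C : ℝ) (l : H → ℝ) : Prop :=
  Differentiable ℝ l ∧ Differentiable ℝ (fderiv ℝ l) ∧
    ∀ x h k : H, ENNReal.ofReal |fderiv ℝ (fderiv ℝ l) x h k| ≤
      ENNReal.ofReal C * ENNReal.ofReal ‖h‖ * weightedNorm f μ α k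

/-- The Riesz representer of `v ↦ D³ l(x) · (h, k, v)`. -/
def thirdDerivVec (l : H → ℝ) (x h k : H) : H :=
  (InnerProductSpace.toDual ℝ H).symm (fderiv ℝ (fderiv ℝ (fderiv ℝ l)) x h k)

/-- `l` is three times differentiable and, for every `N`, the function `l_N = l ∘ P_N` satisfies
`‖D³ l_N(x) · (h, k)‖_α ≤ C ‖h‖₀ ‖k‖₀` and `‖D³ l_N(x) · (h, k)‖₀ ≤ C ‖h‖_{-α} ‖k‖₀` on `H_N`. -/
def ThirdDerivBound (f : HilbertBasis ℕ ℝ H) (μ : ℕ → ℝ) (α C : ℝ) (l : H → ℝ) : Prop :=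
  Differentiable ℝ l ∧ Differentiable ℝ (fderiv ℝ l) ∧
    Differentiable ℝ (fderiv ℝ (fderiv ℝ l)) ∧
    ∀ N : ℕ, ∀ x ∈ galerkinSpace f N, ∀ h ∈ galerkinSpace f N, ∀ k ∈ galerkinSpace f N,
      weightedNorm f μ α (thirdDerivVec (fun y => l (galerkinProj f N y)) x h k) ≤
          ENNReal.ofReal C * weightedNorm f μ 0 h * weightedNorm f μ 0 k ∧
        weightedNorm f μ 0 (thirdDerivVec (fun y => l (galerkinProj f N y)) x h k) ≤
          ENNReal.ofReal C * weightedNorm f μ (-α) h * weightedNorm f μ 0 k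

/-- The empirical risk `L = (1 / m) ∑ᵢ ℓᵢ`. -/
def empiricalRisk {m : ℕ} (l : Fin m → H → ℝ) (x : H) : ℝ :=
  (1 / (m : ℝ)) * ∑ i, l i x

/-- `φ` is bounded and twice continuously differentiable with bounded derivatives. -/
def IsCb2 (φ : H → ℝ) : Prop :=
  ContDiff ℝ 2 φ ∧ BddAbove (Set.range fun x => |φ x|) ∧
    BddAbove (Set.range fun x => ‖∇ φ x‖) ∧
    BddAbove (Set.range fun x => ‖fderiv ℝ (fderiv ℝ φ) x‖)

/-- `‖φ‖_{0,2} = max {sup |φ|, sup ‖∇φ‖, sup ‖D²φ‖}`. -/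
def cb2Norm (φ : H → ℝ) : ℝ :=
  max (⨆ x, |φ x|) (max (⨆ x, ‖∇ φ x‖) (⨆ x, ‖fderiv ℝ (fderiv ℝ φ) x‖))

/-- `σ(u) = 1 / (1 + exp (-u)) - 1 / 2`. -/
def sigmoidShifted (u : ℝ) : ℝ := 1 / (1 + Real.exp (-u)) - 1 / 2

end Loss

section Algorithm

variable {H : Type*} [NormedAddCommGroup H] [InnerProductSpace ℝ H] [CompleteSpace H]
  {Ω : Type*}

/-- The randomness of the algorithms: the cylindrical standard Gaussians `εₙ = ∑ₖ ε n k • fₖ` are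
i.i.d., the minibatches `I n` are i.i.d. uniform among the subsets of size `b` of the `m` data
indices, and the two sequences are independent of each other. -/
structure IsNoise [MeasurableSpace Ω] (P : Measure Ω) {m : ℕ} (b : ℕ)
    (ε : ℕ → ℕ → Ω → ℝ) (I : ℕ → Ω → Finset (Fin m)) : Prop where
  measurable_gauss : ∀ n k, Measurable (ε n k)
  map_gauss : ∀ n k, P.map (ε n k) = gaussianReal 0 1
  indep_gauss : iIndepFun (fun p : ℕ × ℕ => ε p.1 p.2) P
  measurable_batch : ∀ n, Measurable (I n)
  prob_batch : ∀ n, ∀ s : Finset (Fin m), s.card = b →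
    P {ω | I n ω = s} = ((m.choose b : ℕ) : ℝ≥0∞)⁻¹
  indep_batch : iIndepFun I P
  indep_gauss_batch :
    IndepFun (fun ω => fun p : ℕ × ℕ => ε p.1 p.2 ω) (fun ω => fun n => I n ω) P

/-- `P_N εₙ`. -/
def projNoise (f : HilbertBasis ℕ ℝ H) (N : ℕ) (ε : ℕ → ℕ → Ω → ℝ) (n : ℕ) (ω : Ω) : H :=
  ∑ k ∈ Finset.range (N + 1), ε n k ω • f k

/-- The stochastic gradient `(1 / b) ∑_{i ∈ J} ∇ ℓᵢ(x)`. -/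
def batchGradient {m : ℕ} (l : Fin m → H → ℝ) (b : ℕ) (J : Finset (Fin m)) (x : H) : H :=
  (1 / (b : ℝ)) • ∑ i ∈ J, ∇ (l i) x

/-- The Galerkin gradient Langevin dynamics `X_n^N`. -/
def galerkinGLD (f : HilbertBasis ℕ ℝ H) (μ : ℕ → ℝ) (lam β η : ℝ) (N : ℕ) {m : ℕ}
    (l : Fin m → H → ℝ) (x₀ : H) (ε : ℕ → ℕ → Ω → ℝ) : ℕ → Ω → H
  | 0, _ => galerkinProj f N x₀
  | n + 1, ω =>
    let x := galerkinGLD f μ lam β η N l x₀ ε n ω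
    resolventS f μ lam η
      (x - η • galerkinProj f N (∇ (empiricalRisk l) (galerkinProj f N x))
        + Real.sqrt (2 * (η / β)) • projNoise f N ε n ω)

/-- The Galerkin stochastic gradient Langevin dynamics `Y_n^N` with minibatches of size `b`. -/
def galerkinSGLD (f : HilbertBasis ℕ ℝ H) (μ : ℕ → ℝ) (lam β η : ℝ) (N : ℕ) {m : ℕ} (b : ℕ)
    (l : Fin m → H → ℝ) (x₀ : H) (ε : ℕ → ℕ → Ω → ℝ) (I : ℕ → Ω → Finset (Fin m)) : ℕ → Ω → H
  | 0, _ => galerkinProj f N x₀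
  | n + 1, ω =>
    let y := galerkinSGLD f μ lam β η N b l x₀ ε I n ω
    resolventS f μ lam η
      (y - η • galerkinProj f N (batchGradient l b (I n ω) (galerkinProj f N y))
        + Real.sqrt (2 * (η / β)) • projNoise f N ε n ω)

/-- `r_n = n β η (m - b) / (b (m - 1))`. -/
def discrepancyRate (n m b : ℕ) (β η : ℝ) : ℝ :=
  (n : ℝ) * β * η * ((m : ℝ) - b) / ((b : ℝ) * ((m : ℝ) - 1))

end Algorithm

end SGLD

end

open scoped NNReal

/-! Both chains are driven by the same Gaussian noise and differ only in their drifts. In one step,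
replacing the drift `w` by `w'` is the same as translating the standard Gaussian by a vector of norm
at most `(η / s) * ‖w - w'‖`, where `s ^ 2 = 2 * η / β`. By Cameron-Martin this costs relative
entropy at most `(η / s) ^ 2 / 2 * ‖w - w'‖ ^ 2`. Averaged over the minibatch, the squared drift
difference is the variance of a sample mean without replacement, at most `B ^ 2 * (m - b) / (b * (m
- 1))`. Summing over `n` steps gives a total cost of `q = (B / 2) ^ 2 * r`.

The entropy is never formed; its Donsker-Varadhan dual is propagated instead: `E φ(Y n) ≤ log E exp
φ(X n) + q` for all Lipschitz `φ` (`integral_langevinChain_le_log_integral_exp`). The induction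
closes because the one-step log-Laplace transform of a Lipschitz function is Lipschitz
(`abs_logLaplaceStep_sub_le`), and the one-step cost is `integral_comp_diagStep_le`.

For 1-Lipschitz `φ`, apply this to `t * (φ - E φ(X n))`. The log-Laplace transform of a centred
variable with exponential moments is `O(t ^ 2)`, so `t * d ≤ a * t ^ 2 + q` with `d = E φ(Y n) - E
φ(X n)`; choosing `t` of order `√q` yields `d = O(√q)`. Using `-φ` and rescaling gives the two-sided
bound for every Lipschitz `φ`, with the Lipschitz constant as a factor. Each of the three kinds of
test function is Lipschitz, and the term `r ^ (1 / 4)` only enlarges the right side.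

The exponential moments must be uniform in `n`, `N`, `η`, `β`. Each chain stays within `R = 1 + B *
μ 0 / lam` of the linear Gaussian chain with the same noise (`norm_langevinChain_sub_le`), whose
coordinates have variances at most `μ k / lam`. These are summable, so a Gaussian exponential moment
of the norm is bounded (`exp_sq_moment_gaussChain`). -/

namespace SGLD

/-! ### Translation of Gaussian measures and the entropy inequality. -/

section Gaussian

/-- A product of densities is the density of the product measure. -/
theorem pi_withDensity {ι : Type*} [Fintype ι] {E : ι → Type*} [∀ i, MeasurableSpace (E i)]
    (μ : ∀ i, Measure (E i)) [∀ i, IsProbabilityMeasure (μ i)] (g : ∀ i, E i → ℝ≥0∞)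
    (hg : ∀ i, Measurable (g i)) [∀ i, SigmaFinite ((μ i).withDensity (g i))] :
    (Measure.pi μ).withDensity (fun x => ∏ i, g i (x i)) =
      Measure.pi (fun i => (μ i).withDensity (g i)) := by
  classical
  symm
  refine Measure.pi_eq fun s hs => ?_
  rw [withDensity_apply _ (MeasurableSet.univ_pi hs), ← lintegral_indicator (MeasurableSet.univ_pi hs)]
  have h1 : ∀ x : ∀ i, E i, (Set.univ.pi s).indicator (fun x => ∏ i, g i (x i)) x =
      ∏ i, (s i).indicator (g i) (x i) := by
    intro x
    by_cases hx : x ∈ Set.univ.pi s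
    · rw [Set.indicator_of_mem hx]
      exact Finset.prod_congr rfl fun i _ => (Set.indicator_of_mem (hx i trivial) _).symm
    · rw [Set.indicator_of_notMem hx]
      simp only [Set.mem_pi, Set.mem_univ, true_imp_iff, not_forall] at hx
      obtain ⟨i, hi⟩ := hx
      exact (Finset.prod_eq_zero (Finset.mem_univ i) (Set.indicator_of_notMem hi _)).symm
  simp_rw [h1]
  have hm : ∀ i, Measurable ((s i).indicator (g i)) := fun i => (hg i).indicator (hs i)
  have hind : iIndepFun (fun i (x : ∀ i, E i) => (s i).indicator (g i) (x i)) (Measure.pi μ) :=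
    iIndepFun_pi (X := fun i => (s i).indicator (g i)) fun i => (hm i).aemeasurable
  rw [lintegral_prod_eq_prod_lintegral_of_indepFun Finset.univ _ hind
    fun i => (hm i).comp (measurable_pi_apply i)]
  refine Finset.prod_congr rfl fun i _ => ?_
  rw [withDensity_apply _ (hs i), ← lintegral_indicator (hs i)]
  exact (measurePreserving_eval μ i).lintegral_comp (hm i)

/-- Completing the square: `-x ^ 2 / 2 - u * x - u ^ 2 / 2 = -(x + u) ^ 2 / 2`. -/
theorem gaussianReal_withDensity_exp (u : ℝ) :
    (gaussianReal 0 1).withDensity (fun x => ENNReal.ofReal (Real.exp (-(u * x) - u ^ 2 / 2))) =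
      gaussianReal (-u) 1 := by
  rw [gaussianReal_of_var_ne_zero _ one_ne_zero, gaussianReal_of_var_ne_zero _ one_ne_zero,
    ← withDensity_mul _ (measurable_gaussianPDF _ _) (by fun_prop)]
  congr 1
  ext x
  simp only [Pi.mul_apply, gaussianPDF]
  rw [← ENNReal.ofReal_mul (gaussianPDFReal_nonneg _ _ _)]
  congr 1
  simp only [gaussianPDFReal, mul_assoc, ← Real.exp_add]
  congr 2
  simp
  ring

/-- The standard Gaussian measure on `ℝ ^ ι`. -/
noncomputable abbrev stdGauss (ι : Type*) [Fintype ι] : Measure (ι → ℝ) :=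
  Measure.pi fun _ => gaussianReal 0 1

variable {ι : Type*} [Fintype ι]

/-- Cameron-Martin formula for the standard Gaussian measure. -/
theorem stdGauss_eq_map_withDensity (u : ι → ℝ) :
    stdGauss ι = ((stdGauss ι).withDensity
      (fun x => ENNReal.ofReal (Real.exp (-∑ i, u i * x i - (∑ i, u i ^ 2) / 2)))).map
        (fun x => x + u) := by
  have h1 : (fun x : ι → ℝ => ENNReal.ofReal (Real.exp (-∑ i, u i * x i - (∑ i, u i ^ 2) / 2))) =
      fun x => ∏ i, ENNReal.ofReal (Real.exp (-(u i * x i) - u i ^ 2 / 2)) := by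
    ext x
    rw [← ENNReal.ofReal_prod_of_nonneg fun i _ => (Real.exp_pos _).le, ← Real.exp_sum]
    congr 2
    rw [Finset.sum_sub_distrib, Finset.sum_neg_distrib, Finset.sum_div]
  have : ∀ i, SigmaFinite ((gaussianReal 0 1).withDensity
      (fun x => ENNReal.ofReal (Real.exp (-(u i * x) - u i ^ 2 / 2)))) := fun i => by
    rw [gaussianReal_withDensity_exp]; infer_instance
  rw [h1, pi_withDensity (fun _ : ι => gaussianReal 0 1)
    (fun i x => ENNReal.ofReal (Real.exp (-(u i * x) - u i ^ 2 / 2))) (fun i => by fun_prop)]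
  simp_rw [gaussianReal_withDensity_exp]
  have h2 := Measure.pi_map_pi (μ := fun i => gaussianReal (-u i) 1) (f := fun i x => x + u i)
    (fun i => by fun_prop)
  refine Eq.trans ?_ h2.symm
  simp [gaussianReal_map_add_const]

theorem integrable_stdGauss_eval (i : ι) : Integrable (fun x : ι → ℝ => x i) (stdGauss ι) :=
  ((measurePreserving_eval (fun _ : ι => gaussianReal 0 1) i).integrable_comp
    (by fun_prop)).2 ((memLp_id_gaussianReal 1).integrable le_rfl)

theorem integral_stdGauss_eval (i : ι) : ∫ x : ι → ℝ, x i ∂stdGauss ι = 0 := by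
  have := integral_map (μ := stdGauss ι) (φ := fun x : ι → ℝ => x i) (measurable_pi_apply i).aemeasurable
    (f := fun y : ℝ => y) (by fun_prop)
  rw [← this, (measurePreserving_eval (fun _ : ι => gaussianReal 0 1) i).map_eq]
  exact integral_id_gaussianReal

/-- Entropy inequality for the standard Gaussian measure and its translate. -/
theorem exp_integral_translate_le (u : ι → ℝ) (W : (ι → ℝ) → ℝ) (hW : Measurable W)
    (h1 : Integrable (fun x => Real.exp (W x)) (stdGauss ι))
    (h2 : Integrable (fun x => W (x + u)) (stdGauss ι)) :
    Real.exp (∫ x, W (x + u) ∂stdGauss ι - (∑ i, u i ^ 2) / 2) ≤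
      ∫ x, Real.exp (W x) ∂stdGauss ι := by
  -- `q` is the log-density from the Cameron-Martin formula; its mean `-|u| ^ 2 / 2` is the entropy
  -- cost.
  set q : (ι → ℝ) → ℝ := fun x => -∑ i, u i * x i - (∑ i, u i ^ 2) / 2 with hq
  have hqm : Measurable q := by fun_prop
  have hlin : Integrable (fun x : ι → ℝ => ∑ i, u i * x i) (stdGauss ι) :=
    integrable_finsetSum _ fun i _ => (integrable_stdGauss_eval i).const_mul _
  have hqi : Integrable q (stdGauss ι) := hlin.neg.sub (integrable_const _)
  have hq0 : ∫ x, q x ∂stdGauss ι = -(∑ i, u i ^ 2) / 2 := by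
    have h3 : ∫ x, q x ∂stdGauss ι = ∫ x, -∑ i, u i * x i ∂stdGauss ι -
        ∫ _x, (∑ i, u i ^ 2) / 2 ∂stdGauss ι := integral_sub hlin.neg (integrable_const _)
    rw [h3, integral_neg, integral_finsetSum _ fun i _ => (integrable_stdGauss_eval i).const_mul _]
    simp [integral_const_mul, integral_stdGauss_eval, neg_div]
  have hsm : Measurable (fun x : ι → ℝ => ENNReal.ofReal (Real.exp (q x))) := by fun_prop
  have hmap := stdGauss_eq_map_withDensity u
  have htm : Measurable (fun x : ι → ℝ => x + u) := by fun_prop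
  have hEm : Measurable (fun x => Real.exp (W x)) := by fun_prop
  have key : ∀ x, (ENNReal.ofReal (Real.exp (q x))).toReal • Real.exp (W (x + u)) =
      Real.exp (W (x + u) + q x) := fun x => by
    rw [ENNReal.toReal_ofReal (Real.exp_pos _).le, smul_eq_mul, ← Real.exp_add, add_comm]
  have hI : ∫ x, Real.exp (W x) ∂stdGauss ι =
      ∫ x, Real.exp (W (x + u) + q x) ∂stdGauss ι := by
    conv_lhs => rw [hmap]
    rw [integral_map htm.aemeasurable hEm.aestronglyMeasurable,
      integral_withDensity_eq_integral_toReal_smul hsm (by simp)]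
    simp_rw [key]
  have hInt : Integrable (fun x => Real.exp (W (x + u) + q x)) (stdGauss ι) := by
    rw [hmap, integrable_map_measure hEm.aestronglyMeasurable htm.aemeasurable,
      integrable_withDensity_iff_integrable_smul' hsm (by simp)] at h1
    refine h1.congr (Filter.Eventually.of_forall fun x => key x)
  rw [hI]
  -- Jensen for `exp`, after the change of variables has moved the translation into `W`.
  have hJ := convexOn_exp.map_integral_le (μ := stdGauss ι) (f := fun x => W (x + u) + q x)
    Real.continuous_exp.continuousOn isClosed_univ (by simp) (h2.add hqi) hInt
  rw [integral_add h2 hqi, hq0] at hJ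
  convert hJ using 2
  ring

end Gaussian

/-! ### Variance of sampling without replacement. -/

section Batch

variable {H : Type*} [NormedAddCommGroup H] [InnerProductSpace ℝ H]

/-- Removing `i` is a bijection onto the `c`-subsets of the `m - 2` indices other than `i` and `j`.
-/
theorem card_powersetCard_mem_notMem {m c : ℕ} {i j : Fin m} (hij : i ≠ j) :
    ((Finset.powersetCard (c + 1) (Finset.univ : Finset (Fin m))).filter
      (fun J => i ∈ J ∧ j ∉ J)).card = (m - 2).choose c := by
  have h : (Finset.powersetCard c ((Finset.univ.erase i).erase j)).card = (m - 2).choose c := by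
    rw [Finset.card_powersetCard, Finset.card_erase_of_mem (by simp [hij.symm]),
      Finset.card_erase_of_mem (by simp)]
    simp [Nat.sub_sub]
  rw [← h]
  symm
  refine Finset.card_bij' (fun J _ => insert i J) (fun J _ => J.erase i) ?_ ?_ ?_ ?_
  · intro J hJ
    rw [Finset.mem_powersetCard] at hJ
    have hi : i ∉ J := fun h => by simpa using hJ.1 h
    have hj : j ∉ J := fun h => by simpa using hJ.1 h
    simp [Finset.card_insert_of_notMem hi, hJ.2, hj, hij.symm]
  · intro J hJ
    simp only [Finset.mem_filter, Finset.mem_powersetCard] at hJ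
    rw [Finset.mem_powersetCard, Finset.card_erase_of_mem hJ.2.1, hJ.1.2]
    refine ⟨fun x hx => ?_, by simp⟩
    simp only [Finset.mem_erase, Finset.mem_univ, and_true] at hx ⊢
    exact ⟨fun h => hJ.2.2 (h ▸ hx.2), hx.1⟩
  · intro J hJ
    rw [Finset.mem_powersetCard] at hJ
    exact Finset.erase_insert fun h => by simpa using hJ.1 h
  · intro J hJ
    simp only [Finset.mem_filter] at hJ
    exact Finset.insert_erase hJ.2.1

/-- Since the `a i` sum to zero, `‖∑ i ∈ J, a i‖ ^ 2` is minus the sum of `⟪a i, a j⟫` over `i ∈ J`,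
`j ∉ J`. Every ordered pair of distinct indices is separated in this way by equally many `J`, and
the off-diagonal inner products add up to `-∑ ‖a i‖ ^ 2`. -/
theorem sum_powersetCard_norm_sq {m c : ℕ} (a : Fin m → H) (ha : ∑ i, a i = 0) :
    ∑ J ∈ Finset.powersetCard (c + 1) (Finset.univ : Finset (Fin m)), ‖∑ i ∈ J, a i‖ ^ 2 =
      ((m - 2).choose c : ℕ) * ∑ i, ‖a i‖ ^ 2 := by
  have h1 : ∀ J : Finset (Fin m), ‖∑ i ∈ J, a i‖ ^ 2 =
      ∑ i, ∑ j, if i ∈ J ∧ j ∉ J then -⟪a i, a j⟫ else 0 := by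
    intro J
    have h2 : ∑ i ∈ J, a i = -∑ j ∈ Jᶜ, a j := by
      rw [eq_neg_iff_add_eq_zero, Finset.sum_add_sum_compl, ha]
    rw [← real_inner_self_eq_norm_sq]
    conv_lhs => rw [show ⟪∑ i ∈ J, a i, ∑ i ∈ J, a i⟫ = ⟪∑ i ∈ J, a i, -∑ j ∈ Jᶜ, a j⟫ by
      rw [← h2]]
    rw [inner_neg_right, sum_inner, ← Finset.sum_neg_distrib,
      ← Finset.sum_filter_add_sum_filter_not Finset.univ (fun i => i ∈ J)]
    rw [Finset.sum_eq_zero (s := Finset.univ.filter fun i => i ∉ J)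
      (fun i hi => by simp [(Finset.mem_filter.1 hi).2]), add_zero]
    refine Finset.sum_congr (by ext; simp) fun i hi => ?_
    rw [inner_sum, ← Finset.sum_neg_distrib, ← Finset.sum_filter]
    refine Finset.sum_congr ?_ fun _ _ => rfl
    ext j
    simp [(Finset.mem_filter.1 hi).2]
  simp_rw [h1]
  rw [Finset.sum_comm]
  simp_rw [Finset.sum_comm (s := Finset.powersetCard (c + 1) (Finset.univ : Finset (Fin m)))]
  have h3 : ∀ i j : Fin m, ∑ J ∈ Finset.powersetCard (c + 1) (Finset.univ : Finset (Fin m)),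
      (if i ∈ J ∧ j ∉ J then -⟪a i, a j⟫ else 0) =
        ((m - 2).choose c : ℕ) * ((if i = j then ‖a i‖ ^ 2 else 0) - ⟪a i, a j⟫) := by
    intro i j
    rw [← Finset.sum_filter, Finset.sum_const]
    by_cases hij : i = j
    · subst hij
      simp
    · rw [card_powersetCard_mem_notMem hij]
      simp [hij]
  simp_rw [h3, ← Finset.mul_sum, Finset.sum_sub_distrib, ← inner_sum, ha]
  simp

/-- Two absorption identities pass from `m - 2` to `m - 1` and then to `m`. -/
theorem choose_sub_two_mul {m c : ℕ} (hm : 2 ≤ m) (hc : c + 1 ≤ m) :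
    (((m - 2).choose c : ℕ) : ℝ) * (m * (m - 1)) =
      (c + 1 : ℝ) * (m - (c + 1)) * (m.choose (c + 1) : ℕ) := by
  obtain ⟨k, rfl⟩ := Nat.exists_eq_add_of_le' hm
  have h1 := Nat.add_one_mul_choose_eq (k + 1) c
  have h2 := Nat.choose_mul_succ_eq k c
  have h3 : ((k + 1 - c : ℕ) : ℝ) = k + 1 - c := by
    rw [Nat.cast_sub (by omega)]; push_cast; ring
  have h1' : ((k : ℝ) + 1 + 1) * ((k + 1).choose c : ℕ) = ((k + 1 + 1).choose (c + 1) : ℕ) * (c + 1) := by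
    exact_mod_cast h1
  have h2' : ((k.choose c : ℕ) : ℝ) * (k + 1) = ((k + 1).choose c : ℕ) * (k + 1 - c) := by
    rw [← h3]; exact_mod_cast h2
  simp only [Nat.add_sub_cancel]
  push_cast
  linear_combination ((k : ℝ) + 2) * h2' + ((k : ℝ) + 1 - c) * h1'

/-- Variance of the mean of a uniform sample of size `b` without replacement. -/
theorem sum_powersetCard_norm_mean_sub_sq_le {m b : ℕ} (hm : 2 ≤ m) (hb : 1 ≤ b) (hbm : b ≤ m)
    (g : Fin m → H) {B : ℝ} (hg : ∀ i, ‖g i‖ ≤ B) :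
    ∑ J ∈ Finset.powersetCard b (Finset.univ : Finset (Fin m)),
      ((m.choose b : ℕ) : ℝ)⁻¹ * ‖(1 / (m : ℝ)) • ∑ i, g i - (1 / (b : ℝ)) • ∑ i ∈ J, g i‖ ^ 2 ≤
        B ^ 2 * (((m : ℝ) - b) / (b * ((m : ℝ) - 1))) := by
  obtain ⟨c, rfl⟩ := Nat.exists_eq_add_of_le' hb
  have hm0 : (0 : ℝ) < m := by positivity
  have hm2 : (2 : ℝ) ≤ m := by exact_mod_cast hm
  have hbm' : ((c + 1 : ℕ) : ℝ) ≤ m := by exact_mod_cast hbm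
  have hb0 : (0 : ℝ) < (c + 1 : ℕ) := by positivity
  have hC : (0 : ℝ) < (m.choose (c + 1) : ℕ) := by exact_mod_cast Nat.choose_pos hbm
  set e : H := (1 / (m : ℝ)) • ∑ i, g i with he
  have hme : (m : ℝ) • e = ∑ i, g i := by
    rw [he, smul_smul, mul_one_div_cancel hm0.ne', one_smul]
  have ha : ∑ i, (g i - e) = 0 := by
    rw [Finset.sum_sub_distrib, ← hme]
    simp [← Nat.cast_smul_eq_nsmul ℝ]
  have hJ : ∀ J ∈ Finset.powersetCard (c + 1) (Finset.univ : Finset (Fin m)),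
      ((m.choose (c + 1) : ℕ) : ℝ)⁻¹ * ‖e - (1 / ((c + 1 : ℕ) : ℝ)) • ∑ i ∈ J, g i‖ ^ 2 =
        ((m.choose (c + 1) : ℕ) : ℝ)⁻¹ * (1 / ((c + 1 : ℕ) : ℝ)) ^ 2 *
          ‖∑ i ∈ J, (g i - e)‖ ^ 2 := by
    intro J hJ
    have hc := (Finset.mem_powersetCard.1 hJ).2
    have h1 : e - (1 / ((c + 1 : ℕ) : ℝ)) • ∑ i ∈ J, g i =
        -((1 / ((c + 1 : ℕ) : ℝ)) • ∑ i ∈ J, (g i - e)) := by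
      rw [Finset.sum_sub_distrib, Finset.sum_const, hc, ← Nat.cast_smul_eq_nsmul ℝ, smul_sub,
        smul_smul, one_div_mul_cancel hb0.ne', one_smul, neg_sub]
    rw [h1, norm_neg, norm_smul, mul_pow, Real.norm_eq_abs, sq_abs, mul_assoc]
  rw [Finset.sum_congr rfl hJ, ← Finset.mul_sum, sum_powersetCard_norm_sq _ ha]
  have hsum : ∑ i, ‖g i - e‖ ^ 2 ≤ m * B ^ 2 := by
    -- Centring at the mean only decreases the sum of squares.
    have h1 : ∑ i, ‖g i - e‖ ^ 2 = ∑ i, ‖g i‖ ^ 2 - m * ‖e‖ ^ 2 := by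
      simp_rw [norm_sub_sq_real, Finset.sum_add_distrib, Finset.sum_sub_distrib, ← Finset.mul_sum,
        ← sum_inner, ← hme, inner_smul_left, real_inner_self_eq_norm_sq]
      simp
      ring
    have h2 : ∑ i, ‖g i‖ ^ 2 ≤ ∑ _i : Fin m, B ^ 2 :=
      Finset.sum_le_sum fun i _ => pow_le_pow_left₀ (norm_nonneg _) (hg i) 2
    simp only [Finset.sum_const, Finset.card_univ, Fintype.card_fin, nsmul_eq_mul] at h2
    nlinarith [sq_nonneg ‖e‖]
  have hch := choose_sub_two_mul hm hbm
  set Q : ℝ := (((m - 2).choose c : ℕ) : ℝ)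
  have hQ : 0 ≤ Q := Nat.cast_nonneg _
  have hQ' : Q = (c + 1 : ℝ) * (m - (c + 1)) * (m.choose (c + 1) : ℕ) / (m * (m - 1)) := by
    rw [eq_div_iff (by nlinarith), hch]
  calc ((m.choose (c + 1) : ℕ) : ℝ)⁻¹ * (1 / ((c + 1 : ℕ) : ℝ)) ^ 2 * (Q * ∑ i, ‖g i - e‖ ^ 2)
      ≤ ((m.choose (c + 1) : ℕ) : ℝ)⁻¹ * (1 / ((c + 1 : ℕ) : ℝ)) ^ 2 * (Q * (m * B ^ 2)) := by
        gcongr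
    _ = B ^ 2 * (((m : ℝ) - (c + 1 : ℕ)) / ((c + 1 : ℕ) * ((m : ℝ) - 1))) := by
        rw [hQ']
        have : (m : ℝ) - 1 ≠ 0 := by linarith
        have : (c : ℝ) + 1 ≠ 0 := by positivity
        push_cast
        field_simp

end Batch

/-! ### The filtration generated by the iterations. -/

section Past

variable {Ω : Type*} {m : ℕ} {ε : ℕ → ℕ → Ω → ℝ} {I : ℕ → Ω → Finset (Fin m)}

/-- The noise and the minibatches used in the first `n` iterations. -/
def noisePast (N : ℕ) (ε : ℕ → ℕ → Ω → ℝ) (I : ℕ → Ω → Finset (Fin m)) (n : ℕ) (ω : Ω) :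
    ((Finset.range n ×ˢ Finset.range (N + 1) : Finset (ℕ × ℕ)) → ℝ) ×
      (Finset.range n → Finset (Fin m)) :=
  (fun p => ε p.1.1 p.1.2 ω, fun j => I j ω)

/-- The noise and the minibatch of iteration `n`. -/
def noiseNow (N : ℕ) (ε : ℕ → ℕ → Ω → ℝ) (I : ℕ → Ω → Finset (Fin m)) (n : ℕ) (ω : Ω) :
    (Fin (N + 1) → ℝ) × Finset (Fin m) :=
  (fun k => ε n k ω, I n ω)

/-- The `σ`-algebra generated by the first `n` iterations. -/
abbrev pastSigma (N : ℕ) (ε : ℕ → ℕ → Ω → ℝ) (I : ℕ → Ω → Finset (Fin m)) (n : ℕ) :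
    MeasurableSpace Ω :=
  MeasurableSpace.comap (noisePast N ε I n) inferInstance

theorem measurable_noise_past {N n j k : ℕ} (hj : j < n) (hk : k < N + 1) :
    Measurable[pastSigma N ε I n] (ε j k) := by
  have h : Measurable[pastSigma N ε I n] (noisePast N ε I n) := comap_measurable _
  exact ((measurable_pi_apply (⟨(j, k), by simp; omega⟩ :
    (Finset.range n ×ˢ Finset.range (N + 1) : Finset (ℕ × ℕ)))).comp measurable_fst).comp h

theorem measurable_batch_past {N n j : ℕ} (hj : j < n) :
    Measurable[pastSigma N ε I n] (I j) := by
  have h : Measurable[pastSigma N ε I n] (noisePast N ε I n) := comap_measurable _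
  exact ((measurable_pi_apply (⟨j, by simpa using hj⟩ : Finset.range n)).comp measurable_snd).comp h

theorem pastSigma_mono (N : ℕ) (ε : ℕ → ℕ → Ω → ℝ) (I : ℕ → Ω → Finset (Fin m)) {n n' : ℕ}
    (h : n ≤ n') : pastSigma N ε I n ≤ pastSigma N ε I n' := by
  refine Measurable.comap_le (Measurable.prodMk ?_ ?_)
  · refine @measurable_pi_lambda _ _ _ (pastSigma N ε I n') _ _ fun p => ?_
    have hp := Finset.mem_product.1 p.2
    exact measurable_noise_past ((Finset.mem_range.1 hp.1).trans_le h) (Finset.mem_range.1 hp.2)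
  · refine @measurable_pi_lambda _ _ _ (pastSigma N ε I n') _ _ fun j => ?_
    exact measurable_batch_past ((Finset.mem_range.1 j.2).trans_le h)

variable [MeasurableSpace Ω] {P : Measure Ω} {b : ℕ}

theorem measurable_noiseNow (hn : IsNoise P b ε I) (N n : ℕ) : Measurable (noiseNow N ε I n) :=
  Measurable.prodMk (f := fun ω (k : Fin (N + 1)) => ε n k ω)
    (measurable_pi_lambda _ fun k => hn.measurable_gauss n k) (hn.measurable_batch n)

theorem measurable_noisePast (hn : IsNoise P b ε I) (N n : ℕ) : Measurable (noisePast N ε I n) :=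
  (measurable_pi_lambda _ fun _ => hn.measurable_gauss _ _).prodMk
    (measurable_pi_lambda _ fun j => hn.measurable_batch j)

end Past

/-! ### Independence of past and present, and the law of one iteration's randomness. -/

section Independence

variable {Ω : Type*} [MeasurableSpace Ω] {P : Measure Ω} [IsProbabilityMeasure P]

/-- Regroups (past, present) Gaussians and (past, present) minibatches into past and present. It
suffices to test rectangles, a generating π-system, on which all the probabilities factor. -/
theorem indepFun_prodMk_prodMk_of_indepFun {E E' F F' : Type*} [MeasurableSpace E]
    [MeasurableSpace E'] [MeasurableSpace F] [MeasurableSpace F']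
    {A : Ω → E} {A' : Ω → E'} {C : Ω → F} {C' : Ω → F'}
    (hA : Measurable A) (hA' : Measurable A') (hC : Measurable C) (hC' : Measurable C')
    (h1 : IndepFun A A' P) (h2 : IndepFun C C' P)
    (h : IndepFun (fun ω => (A ω, A' ω)) (fun ω => (C ω, C' ω)) P) :
    IndepFun (fun ω => (A ω, C ω)) (fun ω => (A' ω, C' ω)) P := by
  rw [IndepFun_iff_Indep]
  refine IndepSets.indep (hA.prodMk hC).comap_le (hA'.prodMk hC').comap_le
    (isPiSystem_prod.comap _) (isPiSystem_prod.comap _)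
    (by rw [← generateFrom_prod, MeasurableSpace.comap_generateFrom]; rfl)
    (by rw [← generateFrom_prod, MeasurableSpace.comap_generateFrom]; rfl) ?_
  rw [IndepSets_iff]
  rintro _ _ ⟨_, ⟨s, hs, t, ht, rfl⟩, rfl⟩ ⟨_, ⟨s', hs', t', ht', rfl⟩, rfl⟩
  have e1 := h.measure_inter_preimage_eq_mul _ _ (hs.prod hs') (ht.prod ht')
  have eAC : IndepFun A C P := h.comp measurable_fst measurable_fst
  have eAC' : IndepFun A' C' P := h.comp measurable_snd measurable_snd
  have e2 := h1.measure_inter_preimage_eq_mul _ _ hs hs'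
  have e3 := h2.measure_inter_preimage_eq_mul _ _ ht ht'
  have e4 := eAC.measure_inter_preimage_eq_mul _ _ hs ht
  have e5 := eAC'.measure_inter_preimage_eq_mul _ _ hs' ht'
  simp only [Set.mk_preimage_prod] at e1 ⊢
  rw [e4, e5, Set.inter_inter_inter_comm, e1, e2, e3]
  ring

/-- Fubini for the joint law, which is a product. It serves as the Markov property: `Z` is the
current state and `V` the fresh randomness. -/
theorem integral_comp_of_indepFun {E F : Type*} [MeasurableSpace E] [MeasurableSpace F]
    {Z : Ω → E} {V : Ω → F} (hZ : Measurable Z) (hV : Measurable V) (h : IndepFun Z V P)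
    {g : E × F → ℝ} (hg : Measurable g) (hint : Integrable (fun ω => g (Z ω, V ω)) P) :
    Integrable (fun ω => ∫ v, g (Z ω, v) ∂P.map V) P ∧
      ∫ ω, g (Z ω, V ω) ∂P = ∫ ω, ∫ v, g (Z ω, v) ∂P.map V ∂P := by
  have := Measure.isProbabilityMeasure_map (μ := P) hZ.aemeasurable
  have := Measure.isProbabilityMeasure_map (μ := P) hV.aemeasurable
  have hmap := (indepFun_iff_map_prod_eq_prod_map_map hZ.aemeasurable hV.aemeasurable).1 h
  have hi : Integrable g ((P.map Z).prod (P.map V)) := by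
    rw [← hmap]
    exact (integrable_map_measure hg.aestronglyMeasurable (hZ.prodMk hV).aemeasurable).2 hint
  have hsm : StronglyMeasurable (fun z => ∫ v, g (z, v) ∂P.map V) :=
    hg.stronglyMeasurable.integral_prod_right'
  constructor
  · exact (integrable_map_measure hsm.aestronglyMeasurable hZ.aemeasurable).1 hi.integral_prod_left
  · rw [← integral_map hZ.aemeasurable hsm.aestronglyMeasurable, ← integral_prod g hi, ← hmap,
      integral_map (hZ.prodMk hV).aemeasurable hg.aestronglyMeasurable]

variable {m b : ℕ} {ε : ℕ → ℕ → Ω → ℝ} {I : ℕ → Ω → Finset (Fin m)}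

theorem indepFun_noisePast_noiseNow (hn : IsNoise P b ε I) (N n : ℕ) :
    IndepFun (noisePast N ε I n) (noiseNow N ε I n) P := by
  have hA : IndepFun
      (fun ω (p : (Finset.range n ×ˢ Finset.range (N + 1) : Finset (ℕ × ℕ))) => ε p.1.1 p.1.2 ω)
      (fun ω (k : Fin (N + 1)) => ε n k ω) P := by
    have h := iIndepFun.indepFun_finset (Finset.range n ×ˢ Finset.range (N + 1))
      ({n} ×ˢ Finset.range (N + 1))
      (by
        rw [Finset.disjoint_left]
        rintro ⟨j, k⟩ h1 h2
        simp only [Finset.mem_product, Finset.mem_range, Finset.mem_singleton] at h1 h2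
        omega)
      hn.indep_gauss (fun p => hn.measurable_gauss p.1 p.2)
    exact h.comp (ψ := fun (x : ({n} ×ˢ Finset.range (N + 1) : Finset (ℕ × ℕ)) → ℝ)
      (k : Fin (N + 1)) => x ⟨(n, k), by simpa using k.is_le⟩) measurable_id
      (measurable_pi_lambda _ fun k => measurable_pi_apply _)
  have hC : IndepFun (fun ω (j : Finset.range n) => I j ω) (I n) P := by
    have h := iIndepFun.indepFun_finset (Finset.range n) {n} (by simp) hn.indep_batch
      hn.measurable_batch
    exact h.comp (ψ := fun (x : ({n} : Finset ℕ) → Finset (Fin m)) => x ⟨n, by simp⟩)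
      measurable_id (measurable_pi_apply _)
  refine indepFun_prodMk_prodMk_of_indepFun
    (measurable_pi_lambda _ fun p => hn.measurable_gauss p.1.1 p.1.2)
    (measurable_pi_lambda _ fun k => hn.measurable_gauss n k)
    (measurable_pi_lambda _ fun j => hn.measurable_batch j) (hn.measurable_batch n) hA hC ?_
  exact hn.indep_gauss_batch.comp
    (φ := fun x => ((fun (p : (Finset.range n ×ˢ Finset.range (N + 1) : Finset (ℕ × ℕ))) => x p),
      (fun k : Fin (N + 1) => x (n, k))))
    (ψ := fun y => ((fun j : Finset.range n => y j), y n))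
    (Measurable.prodMk
      (f := fun (x : ℕ × ℕ → ℝ)
        (p : (Finset.range n ×ˢ Finset.range (N + 1) : Finset (ℕ × ℕ))) => x p)
      (g := fun x (k : Fin (N + 1)) => x (n, (k : ℕ)))
      (measurable_pi_lambda _ fun p => measurable_pi_apply _)
      (measurable_pi_lambda _ fun p => measurable_pi_apply _))
    (Measurable.prodMk (f := fun (y : ℕ → Finset (Fin m)) (j : Finset.range n) => y j)
      (measurable_pi_lambda _ fun p => measurable_pi_apply _) (measurable_pi_apply n))

theorem indepFun_noiseNow_of_measurable (hn : IsNoise P b ε I) {N n : ℕ} {E : Type*}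
    [MeasurableSpace E] {Z : Ω → E} (hZ : Measurable[pastSigma N ε I n] Z) :
    IndepFun Z (noiseNow N ε I n) P := by
  have h := indepFun_noisePast_noiseNow hn N n
  rw [IndepFun_iff_Indep] at h ⊢
  exact indep_of_indep_of_le_left h hZ.comap_le

theorem map_noiseNow (hn : IsNoise P b ε I) (N n : ℕ) :
    P.map (noiseNow N ε I n) = (stdGauss (Fin (N + 1))).prod (P.map (I n)) := by
  have h1 : IndepFun (fun ω (k : Fin (N + 1)) => ε n k ω) (I n) P :=
    hn.indep_gauss_batch.comp (φ := fun x (k : Fin (N + 1)) => x (n, (k : ℕ)))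
      (ψ := fun y => y n)
      (measurable_pi_lambda _ fun p => measurable_pi_apply _) (measurable_pi_apply _)
  have hm : Measurable (fun ω (k : Fin (N + 1)) => ε n k ω) :=
    measurable_pi_lambda _ fun k => hn.measurable_gauss n k
  have h2 : iIndepFun (fun (k : Fin (N + 1)) => ε n k) P :=
    hn.indep_gauss.precomp (g := fun k : Fin (N + 1) => (n, (k : ℕ)))
      fun a c h => by simpa [Fin.ext_iff] using h
  have h3 := (indepFun_iff_map_prod_eq_prod_map_map hm.aemeasurable
    (hn.measurable_batch n).aemeasurable).1 h1
  have h4 := iIndepFun.map_fun_eq_pi_map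
    (f := fun (k : Fin (N + 1)) => ε n k) (fun k => (hn.measurable_gauss n k).aemeasurable) h2
  simp_rw [hn.map_gauss] at h4
  rw [h4] at h3
  exact h3

/-- The `m.choose b` sets of size `b` already carry total mass one. -/
theorem ae_card_batch (hn : IsNoise P b ε I) (hbm : b ≤ m) (n : ℕ) :
    ∀ᵐ ω ∂P, (I n ω).card = b := by
  have hs : ∀ s : Finset (Fin m), MeasurableSet (I n ⁻¹' {s}) := fun s =>
    hn.measurable_batch n (measurableSet_singleton s)
  have h1 : P (I n ⁻¹' (Finset.powersetCard b Finset.univ : Finset (Finset (Fin m)))) = 1 := by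
    have hC : ((m.choose b : ℕ) : ℝ≥0∞) ≠ 0 := by
      exact_mod_cast (Nat.choose_pos hbm).ne'
    rw [← sum_measure_preimage_singleton _ fun s _ => hs s]
    rw [Finset.sum_congr rfl fun s hs => show P (I n ⁻¹' {s}) = _ from
      hn.prob_batch n s (Finset.mem_powersetCard.1 hs).2]
    simp [ENNReal.mul_inv_cancel hC]
  have h2 := (prob_compl_eq_zero_iff
    (hn.measurable_batch n (Set.toFinite _).measurableSet)).2 h1
  rw [ae_iff]
  refine measure_mono_null (fun ω hω => ?_) h2
  simpa [Finset.mem_powersetCard] using hω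

theorem integral_map_batch (hn : IsNoise P b ε I) (hbm : b ≤ m) (n : ℕ)
    (g : Finset (Fin m) → ℝ) :
    ∫ J, g J ∂P.map (I n) =
      ∑ J ∈ Finset.powersetCard b (Finset.univ : Finset (Fin m)), ((m.choose b : ℕ) : ℝ)⁻¹ * g J := by
  have := Measure.isProbabilityMeasure_map (μ := P) (hn.measurable_batch n).aemeasurable
  have hr : ∀ J, (P.map (I n)).real {J} = P.real {ω | I n ω = J} := fun J => by
    rw [measureReal_def, Measure.map_apply (hn.measurable_batch n) (measurableSet_singleton J)]
    rfl
  rw [integral_fintype Integrable.of_finite]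
  symm
  refine Finset.sum_subset_zero_on_sdiff (Finset.subset_univ _) (fun J hJ => ?_) fun J hJ => ?_
  · have h0 : P {ω | I n ω = J} = 0 := by
      refine measure_mono_null ?_ (ae_iff.1 (ae_card_batch hn hbm n))
      intro ω hω hc
      simp only [Finset.mem_sdiff, Finset.mem_univ, true_and, Finset.mem_powersetCard,
        Finset.subset_univ] at hJ
      exact hJ (hω ▸ hc)
    rw [hr, measureReal_def, h0]
    simp
  · rw [hr, measureReal_def, hn.prob_batch n J (Finset.mem_powersetCard.1 hJ).2]
    simp

end Independence

/-! ### One Langevin step in coordinates. -/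

section Step

variable {H : Type*} [NormedAddCommGroup H] [InnerProductSpace ℝ H]

/-- One Langevin step with diagonal preconditioner `c`, drift `w` and noise coordinates `e`. -/
noncomputable def diagStep (f : HilbertBasis ℕ ℝ H) (c : ℕ → ℝ) (N : ℕ) (η s : ℝ) (w x : H)
    (e : Fin (N + 1) → ℝ) : H :=
  ∑ k : Fin (N + 1), (c k * (⟪f k, x - η • w⟫ + s * e k)) • f k

variable {f : HilbertBasis ℕ ℝ H} {c : ℕ → ℝ} {N : ℕ} {η s : ℝ}

theorem orthonormal_fin (f : HilbertBasis ℕ ℝ H) (N : ℕ) :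
    Orthonormal ℝ (fun k : Fin (N + 1) => f k) :=
  f.orthonormal.comp _ Fin.val_injective

theorem norm_sq_sum_basis (f : HilbertBasis ℕ ℝ H) (N : ℕ) (a : Fin (N + 1) → ℝ) :
    ‖∑ k, a k • f k‖ ^ 2 = ∑ k, a k ^ 2 := by
  rw [← real_inner_self_eq_norm_sq, (orthonormal_fin f N).inner_sum]
  simp [sq]

theorem sum_inner_sq_le (f : HilbertBasis ℕ ℝ H) (N : ℕ) (v : H) :
    ∑ k : Fin (N + 1), ⟪f k, v⟫ ^ 2 ≤ ‖v‖ ^ 2 := by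
  have := (orthonormal_fin f N).sum_inner_products_le (x := v) (s := Finset.univ)
  simpa using this

theorem inner_sum_basis (f : HilbertBasis ℕ ℝ H) (N : ℕ) (a : Fin (N + 1) → ℝ)
    (k : Fin (N + 1)) : ⟪f k, ∑ j, a j • f j⟫ = a k := by
  have := (orthonormal_fin f N).inner_right_fintype a k
  simpa using this

theorem inner_diagStep (w x : H) (e : Fin (N + 1) → ℝ) (k : Fin (N + 1)) :
    ⟪f k, diagStep f c N η s w x e⟫ = c k * (⟪f k, x - η • w⟫ + s * e k) :=
  inner_sum_basis f N _ k

theorem norm_sum_mul_inner_le {ρ : ℝ} (hc : ∀ k, |c k| ≤ ρ) (v : H) :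
    ‖∑ k : Fin (N + 1), (c k * ⟪f k, v⟫) • f k‖ ≤ ρ * ‖v‖ := by
  have hρ : 0 ≤ ρ := (abs_nonneg _).trans (hc 0)
  refine abs_le_of_sq_le_sq' ?_ (by positivity) |>.2
  rw [norm_sq_sum_basis]
  calc ∑ k : Fin (N + 1), (c k * ⟪f k, v⟫) ^ 2
      ≤ ∑ k : Fin (N + 1), ρ ^ 2 * ⟪f k, v⟫ ^ 2 := by
        refine Finset.sum_le_sum fun k _ => ?_
        rw [mul_pow]
        exact mul_le_mul_of_nonneg_right (sq_le_sq' (abs_le.1 (hc k)).1 (abs_le.1 (hc k)).2)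
          (sq_nonneg _)
    _ ≤ (ρ * ‖v‖) ^ 2 := by
        rw [← Finset.mul_sum, mul_pow]
        exact mul_le_mul_of_nonneg_left (sum_inner_sq_le f N v) (sq_nonneg _)

/-- Under the synchronous coupling the noise cancels; what remains is diagonal and is controlled by
Bessel's inequality. -/
theorem norm_diagStep_sub_le {ρ : ℝ} (hc : ∀ k, |c k| ≤ ρ) (hη : 0 ≤ η) (w w' x x' : H)
    (e : Fin (N + 1) → ℝ) :
    ‖diagStep f c N η s w x e - diagStep f c N η s w' x' e‖ ≤
      ρ * (‖x - x'‖ + η * ‖w - w'‖) := by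
  have hρ : 0 ≤ ρ := (abs_nonneg _).trans (hc 0)
  have h : diagStep f c N η s w x e - diagStep f c N η s w' x' e =
      ∑ k : Fin (N + 1), (c k * ⟪f k, (x - x') - η • (w - w')⟫) • f k := by
    rw [diagStep, diagStep, ← Finset.sum_sub_distrib]
    refine Finset.sum_congr rfl fun k _ => ?_
    rw [← sub_smul]
    congr 1
    simp only [inner_sub_right, inner_smul_right]
    ring
  rw [h]
  refine (norm_sum_mul_inner_le hc _).trans (mul_le_mul_of_nonneg_left ?_ hρ)
  refine (norm_sub_le _ _).trans ?_
  rw [norm_smul, Real.norm_eq_abs, abs_of_nonneg hη]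

/-- A crude dimension-dependent bound, used only for integrability, so it does not affect the final
constants. -/
theorem norm_diagStep_sub_noise_le {ρ : ℝ} (hc : ∀ k, |c k| ≤ ρ) (hs : 0 ≤ s) (w x : H)
    (e : Fin (N + 1) → ℝ) :
    ‖diagStep f c N η s w x e - diagStep f c N η s w x 0‖ ≤ ∑ k, ρ * s * |e k| := by
  have h : diagStep f c N η s w x e - diagStep f c N η s w x 0 =
      ∑ k : Fin (N + 1), (c k * (s * e k)) • f k := by
    rw [diagStep, diagStep, ← Finset.sum_sub_distrib]
    refine Finset.sum_congr rfl fun k _ => ?_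
    rw [← sub_smul]
    congr 1
    simp only [Pi.zero_apply]
    ring
  rw [h]
  refine (norm_sum_le _ _).trans (Finset.sum_le_sum fun k _ => ?_)
  rw [norm_smul, f.orthonormal.1 k, mul_one, Real.norm_eq_abs, abs_mul, abs_mul, abs_of_nonneg hs,
    ← mul_assoc]
  exact mul_le_mul_of_nonneg_right (mul_le_mul_of_nonneg_right (hc k) hs) (abs_nonneg _)

/-- Changing the drift amounts to translating the noise. -/
theorem diagStep_eq_translate (hs : s ≠ 0) (w w' x : H) (e : Fin (N + 1) → ℝ) :
    diagStep f c N η s w' x e =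
      diagStep f c N η s w x (e + fun k : Fin (N + 1) => η / s * ⟪f k, w - w'⟫) := by
  refine Finset.sum_congr rfl fun k _ => ?_
  congr 2
  simp only [inner_sub_right, inner_smul_right, Pi.add_apply]
  field_simp
  ring

theorem continuous_diagStep {w : H → H} (hw : Continuous w) :
    Continuous fun p : H × (Fin (N + 1) → ℝ) => diagStep f c N η s (w p.1) p.1 p.2 := by
  unfold diagStep
  fun_prop

end Step

/-! ### Langevin chains with random drift. -/

section Chain

variable {H : Type*} [NormedAddCommGroup H] [InnerProductSpace ℝ H] {Ω : Type*} {m : ℕ}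

/-- The Langevin chain whose drift at iteration `n` is `W (I n)`. -/
noncomputable def langevinChain (f : HilbertBasis ℕ ℝ H) (c : ℕ → ℝ) (N : ℕ) (η s : ℝ)
    (W : Finset (Fin m) → H → H) (x₀ : H) (ε : ℕ → ℕ → Ω → ℝ) (I : ℕ → Ω → Finset (Fin m)) :
    ℕ → Ω → H
  | 0, _ => x₀
  | n + 1, ω => diagStep f c N η s
      (W (I n ω) (langevinChain f c N η s W x₀ ε I n ω))
      (langevinChain f c N η s W x₀ ε I n ω) fun k => ε n k ω

variable {f : HilbertBasis ℕ ℝ H} {c : ℕ → ℝ} {N : ℕ} {η s : ℝ}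
  {W : Finset (Fin m) → H → H} {x₀ : H} {ε : ℕ → ℕ → Ω → ℝ} {I : ℕ → Ω → Finset (Fin m)}

/-- The shared noise cancels, so the distance `d` to the driftless chain becomes at most `ρ * (d + η
* B)`, and `hR` makes `[0, R]` invariant. -/
theorem norm_langevinChain_sub_le {ρ R B : ℝ} (hc : ∀ k, |c k| ≤ ρ) (hη : 0 ≤ η)
    (hR : ρ * (R + η * B) ≤ R) (hx₀ : ‖x₀‖ ≤ R) {ω : Ω} (hW : ∀ n x, ‖W (I n ω) x‖ ≤ B) (n : ℕ) :
    ‖langevinChain f c N η s W x₀ ε I n ω -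
      langevinChain f c N η s (fun _ _ => 0) 0 ε I n ω‖ ≤ R := by
  have hρ : 0 ≤ ρ := (abs_nonneg _).trans (hc 0)
  induction n with
  | zero => simpa [langevinChain] using hx₀
  | succ n ih =>
    refine (norm_diagStep_sub_le hc hη _ _ _ _ _).trans (le_trans ?_ hR)
    rw [sub_zero]
    gcongr
    exact hW n _

variable [MeasurableSpace H] [BorelSpace H]

theorem measurable_diagStep_batch (hW : ∀ J, Continuous (W J)) :
    Measurable fun p : H × ((Fin (N + 1) → ℝ) × Finset (Fin m)) =>
      diagStep f c N η s (W p.2.2 p.1) p.1 p.2.1 := by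
  have h : Measurable fun q : (H × (Fin (N + 1) → ℝ)) × Finset (Fin m) =>
      diagStep f c N η s (W q.2 q.1.1) q.1.1 q.1.2 :=
    measurable_from_prod_countable_left fun J => (continuous_diagStep (hW J)).measurable
  exact h.comp (f := fun p : H × ((Fin (N + 1) → ℝ) × Finset (Fin m)) =>
    ((p.1, p.2.1), p.2.2)) (by fun_prop)

theorem measurable_langevinChain_past (hW : ∀ J, Continuous (W J)) (n : ℕ) :
    Measurable[pastSigma N ε I n] (langevinChain f c N η s W x₀ ε I n) := by
  induction n with
  | zero => exact measurable_const
  | succ n ih =>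
    have h1 : Measurable[pastSigma N ε I (n + 1)] (langevinChain f c N η s W x₀ ε I n) :=
      ih.mono (pastSigma_mono N ε I n.le_succ) le_rfl
    have h2 : Measurable[pastSigma N ε I (n + 1)] (fun ω (k : Fin (N + 1)) => ε n k ω) :=
      @measurable_pi_lambda _ _ _ (pastSigma N ε I (n + 1)) _ _ fun k =>
        measurable_noise_past n.lt_succ_self k.2
    have h3 : Measurable[pastSigma N ε I (n + 1)] (I n) := measurable_batch_past n.lt_succ_self
    exact (measurable_diagStep_batch hW).comp (h1.prodMk (h2.prodMk h3))

end Chain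

/-! ### Exponential moments of Gaussians. -/

section GaussianMoments

theorem integrable_exp_sq_gaussianReal :
    Integrable (fun x => Real.exp (x ^ 2 / 4)) (gaussianReal 0 1) := by
  rw [gaussianReal_of_var_ne_zero _ one_ne_zero,
    integrable_withDensity_iff_integrable_smul' (measurable_gaussianPDF _ _)
      (Filter.Eventually.of_forall fun _ => gaussianPDF_lt_top)]
  refine ((integrable_exp_neg_mul_sq (b := 1 / 4) (by norm_num)).const_mul
    (Real.sqrt (2 * Real.pi))⁻¹).congr (Filter.Eventually.of_forall fun x => ?_)
  simp only [toReal_gaussianPDF, gaussianPDFReal, smul_eq_mul, NNReal.coe_one, mul_one, sub_zero,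
    mul_assoc, ← Real.exp_add]
  congr 2
  ring

/-- The value `E exp (Z ^ 2 / 4)` for a standard Gaussian `Z`. -/
noncomputable def gaussExpSq : ℝ := ∫ x, Real.exp (x ^ 2 / 4) ∂gaussianReal 0 1

theorem gaussExpSq_nonneg : 0 ≤ gaussExpSq := integral_nonneg fun _ => (Real.exp_pos _).le

/-- Rescaling by `√v` reduces to the standard Gaussian, giving one bound for all admissible `a` and
`v`. -/
theorem exp_sq_moment_gaussianReal {v : ℝ≥0} {a : ℝ} (hav : a * v ≤ 1 / 4) :
    Integrable (fun x => Real.exp (a * x ^ 2)) (gaussianReal 0 v) ∧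
      ∫ x, Real.exp (a * x ^ 2) ∂gaussianReal 0 v ≤ gaussExpSq := by
  have hmap : gaussianReal 0 v = (gaussianReal 0 1).map (Real.sqrt v * ·) := by
    rw [gaussianReal_map_const_mul]
    congr 1
    · simp
    · ext; simp
  have hle : ∀ x : ℝ, Real.exp (a * (Real.sqrt v * x) ^ 2) ≤ Real.exp (x ^ 2 / 4) := fun x => by
    rw [mul_pow, Real.sq_sqrt v.coe_nonneg, Real.exp_le_exp]
    nlinarith [sq_nonneg x]
  have hint : Integrable (fun x => Real.exp (a * (Real.sqrt v * x) ^ 2)) (gaussianReal 0 1) :=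
    integrable_exp_sq_gaussianReal.mono' (by fun_prop)
      (Filter.Eventually.of_forall fun x => by
        rw [Real.norm_eq_abs, Real.abs_exp]; exact hle x)
  rw [hmap]
  constructor
  · rwa [integrable_map_measure (by fun_prop) (by fun_prop)]
  · rw [integral_map (by fun_prop) (by fun_prop)]
    exact integral_mono hint integrable_exp_sq_gaussianReal hle

theorem integrable_exp_mul_abs_gaussianReal (a : ℝ) :
    Integrable (fun x => Real.exp (a * |x|)) (gaussianReal 0 1) :=
  integrable_exp_mul_abs (X := fun x => x) (integrable_exp_mul_gaussianReal a)
    (by simpa using integrable_exp_mul_gaussianReal (μ := 0) (v := 1) (-a))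

theorem integrable_exp_sum_abs_stdGauss {ι : Type*} [Fintype ι] (a : ℝ) :
    Integrable (fun x : ι → ℝ => Real.exp (∑ i, a * |x i|)) (stdGauss ι) := by
  simp_rw [Real.exp_sum]
  exact Integrable.fintype_prod (f := fun _ x => Real.exp (a * |x|))
    fun _ => integrable_exp_mul_abs_gaussianReal a

end GaussianMoments

/-! ### Estimates for the resolvent eigenvalues. -/

section Spectrum

variable {μ : ℕ → ℝ} {lam η : ℝ}

/-- The eigenvalues of the resolvent. -/
noncomputable def resolventCoeff (μ : ℕ → ℝ) (lam η : ℝ) (k : ℕ) : ℝ := μ k / (μ k + lam * η)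

theorem resolventCoeff_nonneg (hμ : ∀ k, 0 ≤ μ k) (hlam : 0 < lam) (hη : 0 < η) (k : ℕ) :
    0 ≤ resolventCoeff μ lam η k :=
  div_nonneg (hμ k) (by have := hμ k; positivity)

theorem abs_resolventCoeff_le (hanti : Antitone μ) (hμ : ∀ k, 0 ≤ μ k) (hlam : 0 < lam)
    (hη : 0 < η) (k : ℕ) : |resolventCoeff μ lam η k| ≤ resolventCoeff μ lam η 0 := by
  rw [abs_of_nonneg (resolventCoeff_nonneg hμ hlam hη k)]
  have h0 := hμ 0
  have hk := hμ k
  have h := hanti (Nat.zero_le k)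
  have hp : 0 < lam * η := by positivity
  rw [resolventCoeff, resolventCoeff, div_le_div_iff₀ (by positivity) (by positivity)]
  nlinarith

/-- `B * μ 0 / lam` is the fixed point of `R ↦ c₀ * (R + η * B)`, with `c₀` the top resolvent
coefficient, and does not depend on `η`. The additional `1` leaves room for the initial point. -/
theorem resolventCoeff_mul_radius_le (hμ : ∀ k, 0 ≤ μ k) (hlam : 0 < lam) (hη : 0 < η) {B : ℝ} :
    resolventCoeff μ lam η 0 * (1 + B * μ 0 / lam + η * B) ≤ 1 + B * μ 0 / lam := by
  have h0 := hμ 0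
  have hp : 0 < lam * η := by positivity
  rw [resolventCoeff, div_mul_eq_mul_div, div_le_iff₀ (by positivity)]
  have : B * μ 0 / lam * (lam * η) = B * μ 0 * η := by field_simp
  nlinarith

/-- Stationary variance bound: `μ k / lam` is a supersolution of the recursion `v ↦ c ^ 2 * (v + 2 *
η)`, because `μ * (μ + 2 * lam * η) ≤ (μ + lam * η) ^ 2`. -/
theorem resolventCoeff_sq_mul_variance_le (hμ : ∀ k, 0 ≤ μ k) (hlam : 0 < lam) (hη : 0 < η)
    {q v : ℝ} (k : ℕ) (hq : q ≤ 2 * η) (hv : v ≤ μ k / lam) :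
    resolventCoeff μ lam η k ^ 2 * (v + q) ≤ μ k / lam := by
  have hk := hμ k
  have hp : 0 < lam * η := by positivity
  have h1 : resolventCoeff μ lam η k ^ 2 * (v + q) ≤
      resolventCoeff μ lam η k ^ 2 * (μ k / lam + 2 * η) := by gcongr
  refine h1.trans ?_
  rw [resolventCoeff, div_pow, div_mul_eq_mul_div, div_le_iff₀ (by positivity)]
  have e1 : μ k ^ 2 * (μ k / lam + 2 * η) = μ k / lam * (μ k * (μ k + 2 * (lam * η))) := by
    field_simp
  rw [e1]
  refine mul_le_mul_of_nonneg_left ?_ (by positivity)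
  nlinarith [sq_nonneg (lam * η)]

end Spectrum

/-! ### Exponential moments of the Gaussian chain. -/

section ChainMoments

variable {H : Type*} [NormedAddCommGroup H] [InnerProductSpace ℝ H] [MeasurableSpace H]
  [BorelSpace H] {Ω : Type*} [MeasurableSpace Ω] {P : Measure Ω}
  {m b : ℕ} {ε : ℕ → ℕ → Ω → ℝ} {I : ℕ → Ω → Finset (Fin m)}

/-- The Gaussian part of the Langevin chains. -/
noncomputable abbrev gaussChain (f : HilbertBasis ℕ ℝ H) (c : ℕ → ℝ) (N : ℕ) (η s : ℝ)
    (ε : ℕ → ℕ → Ω → ℝ) (I : ℕ → Ω → Finset (Fin m)) : ℕ → Ω → H :=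
  langevinChain f c N η s (fun _ _ => 0) 0 ε I

variable (f : HilbertBasis ℕ ℝ H) {μ : ℕ → ℝ} {lam η s : ℝ} {N : ℕ}

theorem measurable_langevinChain {c : ℕ → ℝ} {W : Finset (Fin m) → H → H}
    (hn : IsNoise P b ε I) (hW : ∀ J, Continuous (W J)) (x₀ : H) (n : ℕ) :
    Measurable (langevinChain f c N η s W x₀ ε I n) :=
  (measurable_langevinChain_past hW n).mono (measurable_noisePast hn N n).comap_le le_rfl

variable [IsProbabilityMeasure P]

/-- Each coordinate is an autoregression `g ↦ c k * g + c k * s * ε n k` with fresh noise, hence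
stays centred Gaussian. -/
theorem map_inner_gaussChain (hn : IsNoise P b ε I) (hμ : ∀ k, 0 ≤ μ k) (hlam : 0 < lam)
    (hη : 0 < η) (hs : s ^ 2 ≤ 2 * η) (n : ℕ) (k : Fin (N + 1)) :
    ∃ v : ℝ≥0, (v : ℝ) ≤ μ k / lam ∧
      P.map (fun ω => ⟪f k, gaussChain f (resolventCoeff μ lam η) N η s ε I n ω⟫) =
        gaussianReal 0 v := by
  induction n with
  | zero =>
    refine ⟨0, by simpa using div_nonneg (hμ k) hlam.le, ?_⟩
    simp [gaussChain, langevinChain, gaussianReal_zero_var, Measure.map_const]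
  | succ n ih =>
    obtain ⟨v, hv, hmap⟩ := ih
    set c := resolventCoeff μ lam η with hc
    have hcont : ∀ J : Finset (Fin m), Continuous ((fun _ _ => 0 : Finset (Fin m) → H → H) J) :=
      fun _ => continuous_const
    have hmeas : Measurable (gaussChain f c N η s ε I n) := measurable_langevinChain f hn hcont 0 n
    have hind0 := indepFun_noiseNow_of_measurable hn
      (measurable_langevinChain_past (f := f) (c := c) (N := N) (η := η) (s := s) (x₀ := 0)
        (ε := ε) (I := I) hcont n)
    have hind : IndepFun (fun ω => c k * ⟪f k, gaussChain f c N η s ε I n ω⟫)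
        (fun ω => c k * s * ε n k ω) P :=
      hind0.comp (φ := fun x => c k * ⟪f k, x⟫) (ψ := fun y : (Fin (N + 1) → ℝ) × Finset (Fin m) => c k * s * y.1 k)
        (by fun_prop) (by fun_prop)
    have h1 : P.map (fun ω => c k * ⟪f k, gaussChain f c N η s ε I n ω⟫) =
        gaussianReal 0 (⟨c k ^ 2, sq_nonneg _⟩ * v) := by
      have h := gaussianReal_map_const_mul (μ := 0) (v := v) (c k)
      rw [← hmap, Measure.map_map (by fun_prop) (by fun_prop), mul_zero] at h
      exact h
    have h2 : P.map (fun ω => c k * s * ε n k ω) =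
        gaussianReal 0 (⟨(c k * s) ^ 2, sq_nonneg _⟩ * 1) := by
      have h := gaussianReal_map_const_mul (μ := 0) (v := 1) (c k * s)
      rw [← hn.map_gauss n k, Measure.map_map (by fun_prop) (hn.measurable_gauss n k),
        mul_zero] at h
      exact h
    have h3 := gaussianReal_add_gaussianReal_of_indepFun hind h1 h2
    refine ⟨_, ?_, (congrArg (fun g => P.map g) ?_).trans (h3.trans (by rw [add_zero]))⟩
    · have := resolventCoeff_sq_mul_variance_le hμ hlam hη k hs hv
      push_cast
      change c k ^ 2 * (v : ℝ) + (c k * s) ^ 2 * 1 ≤ _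
      rw [← hc] at this
      linarith [this]
    · ext ω
      simp only [gaussChain, langevinChain, inner_diagStep, smul_zero, sub_zero, Pi.add_apply]
      ring

/-- Jensen with weights `τ k / T` reduces to one coordinate at a time, so independence of the
coordinates is not needed. The weights come from a strictly positive majorant because `μ k` may
vanish, and the divisor would then be zero. -/
theorem exp_sq_moment_gaussChain (hn : IsNoise P b ε I) (hμ : ∀ k, 0 ≤ μ k) (hlam : 0 < lam)
    (hη : 0 < η) (hs : s ^ 2 ≤ 2 * η) {τ : ℕ → ℝ} (hτ : ∀ k, 0 < τ k) (hμτ : ∀ k, μ k ≤ τ k)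
    (hsum : Summable τ) (n : ℕ) :
    Integrable (fun ω => Real.exp (lam / (4 * ∑' k, τ k) *
      ‖gaussChain f (resolventCoeff μ lam η) N η s ε I n ω‖ ^ 2)) P ∧
    ∫ ω, Real.exp (lam / (4 * ∑' k, τ k) *
      ‖gaussChain f (resolventCoeff μ lam η) N η s ε I n ω‖ ^ 2) ∂P ≤ gaussExpSq := by
  set c := resolventCoeff μ lam η
  have hcont : ∀ J : Finset (Fin m), Continuous ((fun _ _ => 0 : Finset (Fin m) → H → H) J) :=
    fun _ => continuous_const
  have hmeas : Measurable (gaussChain f c N η s ε I n) := measurable_langevinChain f hn hcont 0 n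
  set G := gaussChain f c N η s ε I n
  set S := ∑' k, τ k
  set T := ∑ k : Fin (N + 1), τ k
  have hT : 0 < T := Finset.sum_pos (fun k _ => hτ k) ⟨0, Finset.mem_univ _⟩
  have hTS : T ≤ S := by
    have : T = ∑ k ∈ Finset.range (N + 1), τ k := (Finset.sum_range τ).symm
    rw [this]
    exact hsum.sum_le_tsum _ fun k _ => (hτ k).le
  have hS : 0 < S := hT.trans_le hTS
  have hnorm : ∀ ω, ‖G ω‖ ^ 2 = ∑ k : Fin (N + 1), ⟪f k, G ω⟫ ^ 2 := by
    intro ω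
    obtain ⟨a, ha⟩ : ∃ a : Fin (N + 1) → ℝ, G ω = ∑ k, a k • f k := by
      rcases n with _ | n
      · exact ⟨0, by simp [G, gaussChain, langevinChain]⟩
      · exact ⟨_, rfl⟩
    rw [ha, norm_sq_sum_basis]
    exact Finset.sum_congr rfl fun k _ => by rw [inner_sum_basis]
  have hcoord : ∀ k : Fin (N + 1),
      Integrable (fun ω => Real.exp (lam * T / (4 * S * τ k) * ⟪f k, G ω⟫ ^ 2)) P ∧
      ∫ ω, Real.exp (lam * T / (4 * S * τ k) * ⟪f k, G ω⟫ ^ 2) ∂P ≤ gaussExpSq := by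
    intro k
    obtain ⟨v, hv, hmap⟩ := map_inner_gaussChain f hn hμ hlam hη hs n k
    have hk := hτ k
    have hav : lam * T / (4 * S * τ k) * v ≤ 1 / 4 := by
      calc lam * T / (4 * S * τ k) * v ≤ lam * S / (4 * S * τ k) * (τ k / lam) := by
            gcongr
            exact hv.trans (by gcongr; exact hμτ k)
        _ = 1 / 4 := by field_simp
    have h := exp_sq_moment_gaussianReal hav
    have hGk : AEMeasurable (fun ω => ⟪f k, G ω⟫) P :=
      ((continuous_const.inner continuous_id).measurable.comp hmeas).aemeasurable
    rw [← hmap] at h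
    rw [integrable_map_measure (by fun_prop) hGk, integral_map hGk (by fun_prop)] at h
    exact h
  have hle : ∀ ω, Real.exp (lam / (4 * S) * ‖G ω‖ ^ 2) ≤
      ∑ k : Fin (N + 1), τ k / T * Real.exp (lam * T / (4 * S * τ k) * ⟪f k, G ω⟫ ^ 2) := by
    intro ω
    have h := convexOn_exp.map_sum_le (t := Finset.univ) (w := fun k : Fin (N + 1) => τ k / T)
      (p := fun k => lam * T / (4 * S * τ k) * ⟪f k, G ω⟫ ^ 2)
      (fun k _ => div_nonneg (hτ k).le hT.le) (by rw [← Finset.sum_div]; exact div_self hT.ne')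
      (fun _ _ => Set.mem_univ _)
    simp only [smul_eq_mul] at h
    refine le_trans (le_of_eq ?_) h
    rw [hnorm, Finset.mul_sum]
    congr 1
    refine Finset.sum_congr rfl fun k _ => ?_
    have := (hτ k).ne'
    field_simp
  have hint : Integrable (fun ω => ∑ k : Fin (N + 1), τ k / T *
      Real.exp (lam * T / (4 * S * τ k) * ⟪f k, G ω⟫ ^ 2)) P :=
    integrable_finsetSum _ fun k _ => (hcoord k).1.const_mul _
  have hint' : Integrable (fun ω => Real.exp (lam / (4 * S) * ‖G ω‖ ^ 2)) P :=
    hint.mono' ((hmeas.norm.pow_const 2).const_mul _).exp.aestronglyMeasurable (Filter.Eventually.of_forall fun x => by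
      rw [Real.norm_eq_abs, Real.abs_exp]; exact hle x)
  refine ⟨hint', (integral_mono hint' hint hle).trans ?_⟩
  rw [integral_finsetSum _ fun k _ => (hcoord k).1.const_mul _]
  simp_rw [integral_const_mul]
  calc ∑ k : Fin (N + 1), τ k / T * ∫ ω, Real.exp (lam * T / (4 * S * τ k) * ⟪f k, G ω⟫ ^ 2) ∂P
      ≤ ∑ k : Fin (N + 1), τ k / T * gaussExpSq :=
        Finset.sum_le_sum fun k _ => mul_le_mul_of_nonneg_left (hcoord k).2
          (div_nonneg (hτ k).le hT.le)
    _ = gaussExpSq := by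
        rw [← Finset.sum_mul, ← Finset.sum_div, div_self hT.ne', one_mul]

end ChainMoments

/-! ### Integrability of Lipschitz functions. -/

section LipschitzMoments

variable {H : Type*} [NormedAddCommGroup H] {K : ℝ} {φ : H → ℝ}

theorem continuous_of_norm_sub_le {E : Type*} [NormedAddCommGroup E] {g : H → E} {M : ℝ}
    (hg : ∀ x y, ‖g x - g y‖ ≤ M * ‖x - y‖) : Continuous g := by
  refine (LipschitzWith.of_dist_le_mul (K := M.toNNReal) fun x y => ?_).continuous
  rw [dist_eq_norm, dist_eq_norm]
  exact (hg x y).trans (mul_le_mul_of_nonneg_right (Real.le_coe_toNNReal M) (norm_nonneg _))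

theorem continuous_of_abs_sub_le (hφ : ∀ x y, |φ x - φ y| ≤ K * ‖x - y‖) : Continuous φ :=
  continuous_of_norm_sub_le hφ

variable [MeasurableSpace H] [BorelSpace H] {Ω : Type*} [MeasurableSpace Ω] {P : Measure Ω}

theorem integrable_exp_comp_of_integrable_exp_norm {X : Ω → H} (hX : Measurable X)
    (hi : Integrable (fun ω => Real.exp (K * ‖X ω‖)) P)
    (hφ : ∀ x y, |φ x - φ y| ≤ K * ‖x - y‖) :
    Integrable (fun ω => Real.exp (φ (X ω))) P := by
  refine (hi.const_mul (Real.exp (φ 0))).mono'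
    ((continuous_of_abs_sub_le hφ).measurable.comp hX).exp.aestronglyMeasurable
    (Filter.Eventually.of_forall fun ω => ?_)
  rw [Real.norm_eq_abs, Real.abs_exp, ← Real.exp_add, Real.exp_le_exp]
  have h1 := (abs_le.1 (hφ (X ω) 0)).2
  rw [sub_zero] at h1
  linarith

variable [IsProbabilityMeasure P]

theorem integrable_comp_of_integrable_norm {X : Ω → H} (hX : Measurable X)
    (hi : Integrable (fun ω => ‖X ω‖) P) (hφ : ∀ x y, |φ x - φ y| ≤ K * ‖x - y‖) :
    Integrable (fun ω => φ (X ω)) P := by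
  refine ((integrable_const |φ 0|).add (hi.const_mul K)).mono'
    ((continuous_of_abs_sub_le hφ).measurable.comp hX).aestronglyMeasurable
    (Filter.Eventually.of_forall fun ω => ?_)
  have h1 := hφ (X ω) 0
  have h2 := abs_sub_abs_le_abs_sub (φ (X ω)) (φ 0)
  rw [sub_zero] at h1
  simp only [Real.norm_eq_abs, Pi.add_apply]
  linarith

end LipschitzMoments

/-! ### Donsker-Varadhan comparison along the chains. -/

section Entropy

variable {H : Type*} [NormedAddCommGroup H] [InnerProductSpace ℝ H]
  {f : HilbertBasis ℕ ℝ H} {c : ℕ → ℝ} {N : ℕ} {η s ρ K : ℝ} {φ : H → ℝ}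

theorem continuous_diagStep_noise (w y : H) :
    Continuous fun e : Fin (N + 1) → ℝ => diagStep f c N η s w y e := by
  unfold diagStep
  fun_prop

theorem abs_comp_diagStep_sub_le (hc : ∀ k, |c k| ≤ ρ) (hs : 0 ≤ s) (hK : 0 ≤ K)
    (hφ : ∀ x y, |φ x - φ y| ≤ K * ‖x - y‖) (w y : H) (e : Fin (N + 1) → ℝ) :
    |φ (diagStep f c N η s w y e) - φ (diagStep f c N η s w y 0)| ≤
      ∑ k, K * (ρ * s) * |e k| := by
  refine (hφ _ _).trans ((mul_le_mul_of_nonneg_left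
    (norm_diagStep_sub_noise_le hc hs w y e) hK).trans (le_of_eq ?_))
  rw [Finset.mul_sum]
  exact Finset.sum_congr rfl fun k _ => by ring

theorem integrable_exp_comp_diagStep (hc : ∀ k, |c k| ≤ ρ) (hs : 0 ≤ s) (hK : 0 ≤ K)
    (hφ : ∀ x y, |φ x - φ y| ≤ K * ‖x - y‖) (w y : H) :
    Integrable (fun e => Real.exp (φ (diagStep f c N η s w y e))) (stdGauss (Fin (N + 1))) := by
  have hcont := (continuous_of_abs_sub_le hφ).comp (continuous_diagStep_noise (f := f) (c := c)
    (N := N) (η := η) (s := s) w y)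
  refine ((integrable_exp_sum_abs_stdGauss (K * (ρ * s))).const_mul
    (Real.exp (φ (diagStep f c N η s w y 0)))).mono'
    (Real.continuous_exp.comp hcont).aestronglyMeasurable (Filter.Eventually.of_forall fun e => ?_)
  rw [Real.norm_eq_abs, Real.abs_exp, ← Real.exp_add, Real.exp_le_exp]
  have := (abs_le.1 (abs_comp_diagStep_sub_le (f := f) (η := η) hc hs hK hφ w y e)).2
  linarith

theorem integrable_comp_diagStep (hc : ∀ k, |c k| ≤ ρ) (hs : 0 ≤ s) (hK : 0 ≤ K)
    (hφ : ∀ x y, |φ x - φ y| ≤ K * ‖x - y‖) (w y : H) :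
    Integrable (fun e => φ (diagStep f c N η s w y e)) (stdGauss (Fin (N + 1))) := by
  have hcont := (continuous_of_abs_sub_le hφ).comp (continuous_diagStep_noise (f := f) (c := c)
    (N := N) (η := η) (s := s) w y)
  have hi : Integrable (fun e : Fin (N + 1) → ℝ => ∑ k, K * (ρ * s) * |e k|)
      (stdGauss (Fin (N + 1))) :=
    integrable_finsetSum _ fun k _ => (integrable_stdGauss_eval k).abs.const_mul _
  refine ((integrable_const (|φ (diagStep f c N η s w y 0)|)).add hi).mono'
    hcont.aestronglyMeasurable (Filter.Eventually.of_forall fun e => ?_)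
  have := abs_comp_diagStep_sub_le (f := f) (η := η) hc hs hK hφ w y e
  have h2 := abs_sub_abs_le_abs_sub (φ (diagStep f c N η s w y e)) (φ (diagStep f c N η s w y 0))
  simp only [Real.norm_eq_abs, Pi.add_apply]
  linarith

/-- The logarithmic Laplace transform of `φ` after one Langevin step. -/
noncomputable def logLaplaceStep (f : HilbertBasis ℕ ℝ H) (c : ℕ → ℝ) (N : ℕ) (η s : ℝ)
    (w : H → H) (φ : H → ℝ) (y : H) : ℝ :=
  Real.log (∫ e, Real.exp (φ (diagStep f c N η s (w y) y e)) ∂stdGauss (Fin (N + 1)))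

theorem integral_exp_comp_diagStep_pos (hc : ∀ k, |c k| ≤ ρ) (hs : 0 ≤ s) (hK : 0 ≤ K)
    (hφ : ∀ x y, |φ x - φ y| ≤ K * ‖x - y‖) (w y : H) :
    0 < ∫ e, Real.exp (φ (diagStep f c N η s w y e)) ∂stdGauss (Fin (N + 1)) :=
  integral_exp_pos (integrable_exp_comp_diagStep hc hs hK hφ w y)

/-- The drift `w'` is the drift `w` with the noise translated by `u`; the entropy inequality charges
`|u| ^ 2 / 2`, which Bessel bounds. -/
theorem integral_comp_diagStep_le (hc : ∀ k, |c k| ≤ ρ) (hs : 0 < s) (hK : 0 ≤ K)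
    (hφ : ∀ x y, |φ x - φ y| ≤ K * ‖x - y‖) (w : H → H) (w' y : H) :
    ∫ e, φ (diagStep f c N η s w' y e) ∂stdGauss (Fin (N + 1)) ≤
      logLaplaceStep f c N η s w φ y + (η / s) ^ 2 / 2 * ‖w y - w'‖ ^ 2 := by
  set u : Fin (N + 1) → ℝ := fun k => η / s * ⟪f k, w y - w'⟫ with hu
  have hW : Measurable fun e => φ (diagStep f c N η s (w y) y e) :=
    ((continuous_of_abs_sub_le hφ).comp (continuous_diagStep_noise (w y) y)).measurable
  have hi := integrable_comp_diagStep (f := f) (N := N) (η := η) hc hs.le hK hφ w' y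
  simp_rw [diagStep_eq_translate hs.ne' (w y) w' y] at hi ⊢
  have h := exp_integral_translate_le u _ hW
    (integrable_exp_comp_diagStep hc hs.le hK hφ (w y) y) hi
  have h2 := (Real.le_log_iff_exp_le
    (integral_exp_comp_diagStep_pos hc hs.le hK hφ (w y) y)).2 h
  have h3 : ∑ k, u k ^ 2 ≤ (η / s) ^ 2 * ‖w y - w'‖ ^ 2 := by
    simp_rw [hu, mul_pow, ← Finset.mul_sum]
    exact mul_le_mul_of_nonneg_left (sum_inner_sq_le f N _) (sq_nonneg _)
  rw [logLaplaceStep]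
  linarith

/-- With the same noise from `x` and `y` the exponents differ by a deterministic amount, which
factors out of the integral. The Lipschitz constant may grow from step to step, but it does not
enter the entropy cost. -/
theorem abs_logLaplaceStep_sub_le (hc : ∀ k, |c k| ≤ ρ) (hη : 0 ≤ η) (hs : 0 ≤ s) (hK : 0 ≤ K)
    (hφ : ∀ x y, |φ x - φ y| ≤ K * ‖x - y‖) {w : H → H} {Lw : ℝ}
    (hw : ∀ x y, ‖w x - w y‖ ≤ Lw * ‖x - y‖) (x y : H) :
    |logLaplaceStep f c N η s w φ x - logLaplaceStep f c N η s w φ y| ≤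
      K * (ρ * (1 + η * Lw)) * ‖x - y‖ := by
  have hρ : 0 ≤ ρ := (abs_nonneg _).trans (hc 0)
  have key : ∀ x y, logLaplaceStep f c N η s w φ x ≤
      logLaplaceStep f c N η s w φ y + K * (ρ * (1 + η * Lw)) * ‖x - y‖ := by
    intro x y
    rw [logLaplaceStep, logLaplaceStep,
      Real.log_le_iff_le_exp (integral_exp_comp_diagStep_pos hc hs hK hφ _ _), Real.exp_add,
      Real.exp_log (integral_exp_comp_diagStep_pos hc hs hK hφ _ _), ← integral_mul_const]
    refine integral_mono (integrable_exp_comp_diagStep hc hs hK hφ _ _)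
      ((integrable_exp_comp_diagStep hc hs hK hφ _ _).mul_const _) fun e => ?_
    simp only
    rw [← Real.exp_add, Real.exp_le_exp]
    have h1 := (abs_le.1 (hφ (diagStep f c N η s (w x) x e) (diagStep f c N η s (w y) y e))).2
    have h2 : K * ‖diagStep f c N η s (w x) x e - diagStep f c N η s (w y) y e‖ ≤
        K * (ρ * (1 + η * Lw)) * ‖x - y‖ := by
      rw [mul_assoc]
      refine mul_le_mul_of_nonneg_left ((norm_diagStep_sub_le hc hη _ _ _ _ _).trans ?_) hK
      rw [mul_assoc]
      refine mul_le_mul_of_nonneg_left ?_ hρ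
      nlinarith [mul_le_mul_of_nonneg_left (hw x y) hη]
    linarith
  rw [abs_le]
  have h1 := key x y
  have h2 := key y x
  rw [norm_sub_rev] at h2
  constructor <;> linarith

variable [MeasurableSpace H] [BorelSpace H] {Ω : Type*} [MeasurableSpace Ω] {P : Measure Ω}

variable [IsProbabilityMeasure P]

variable {m b : ℕ} {ε : ℕ → ℕ → Ω → ℝ} {I : ℕ → Ω → Finset (Fin m)}

/-- Donsker-Varadhan comparison of two Langevin chains that differ in their drifts. -/
theorem integral_langevinChain_le_log_integral_exp (hn : IsNoise P b ε I)
    (hc : ∀ k, |c k| ≤ ρ) (hη : 0 ≤ η) (hs : 0 < s) {w : H → H} {Lw : ℝ} (hLw : 0 ≤ Lw)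
    (hw : ∀ x y, ‖w x - w y‖ ≤ Lw * ‖x - y‖) {W : Finset (Fin m) → H → H}
    (hW : ∀ J, Continuous (W J)) {V : ℝ}
    (hV : ∀ n y, ∫ J, ‖w y - W J y‖ ^ 2 ∂P.map (I n) ≤ V) (x₀ : H)
    (hX : ∀ n a, Integrable
      (fun ω => Real.exp (a * ‖langevinChain f c N η s (fun _ => w) x₀ ε I n ω‖)) P)
    (hY : ∀ n, Integrable (fun ω => ‖langevinChain f c N η s W x₀ ε I n ω‖) P) (n : ℕ) :
    ∀ (K : ℝ) (φ : H → ℝ), 0 ≤ K → (∀ x y, |φ x - φ y| ≤ K * ‖x - y‖) →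
      ∫ ω, φ (langevinChain f c N η s W x₀ ε I n ω) ∂P ≤
        Real.log (∫ ω, Real.exp (φ (langevinChain f c N η s (fun _ => w) x₀ ε I n ω)) ∂P) +
          n * ((η / s) ^ 2 / 2 * V) := by
  have hρ : 0 ≤ ρ := (abs_nonneg _).trans (hc 0)
  have hwc : Continuous w := continuous_of_norm_sub_le hw
  induction n with
  | zero =>
    intro K φ _ _
    simp [langevinChain]
  | succ n ih =>
    intro K φ hK hφ
    set X := langevinChain f c N η s (fun _ : Finset (Fin m) => w) x₀ ε I
    set Y := langevinChain f c N η s W x₀ ε I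
    set ψ := logLaplaceStep f c N η s w φ
    have hK' : 0 ≤ K * (ρ * (1 + η * Lw)) := by positivity
    have hψ : ∀ x y, |ψ x - ψ y| ≤ K * (ρ * (1 + η * Lw)) * ‖x - y‖ :=
      abs_logLaplaceStep_sub_le hc hη hs.le hK hφ hw
    have hφm := (continuous_of_abs_sub_le hφ).measurable
    have hXm : ∀ n, Measurable (X n) := measurable_langevinChain f hn (fun _ => hwc) x₀
    have hYm : ∀ n, Measurable (Y n) := measurable_langevinChain f hn hW x₀
    have hVm := measurable_noiseNow hn N n
    have := Measure.isProbabilityMeasure_map (μ := P) (hn.measurable_batch n).aemeasurable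
    have hXind : IndepFun (X n) (noiseNow N ε I n) P :=
      indepFun_noiseNow_of_measurable hn (measurable_langevinChain_past (fun _ => hwc) n)
    have hYind : IndepFun (Y n) (noiseNow N ε I n) P :=
      indepFun_noiseNow_of_measurable hn (measurable_langevinChain_past hW n)
    -- Markov property for `X`: the definition of `ψ` makes this step an exact identity.
    have hXint : ∫ ω, Real.exp (φ (X (n + 1) ω)) ∂P = ∫ ω, Real.exp (ψ (X n ω)) ∂P := by
      have h := (integral_comp_of_indepFun (hXm n) hVm hXind
        (g := fun p => Real.exp (φ (diagStep f c N η s (w p.1) p.1 p.2.1)))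
        (hφm.comp (measurable_diagStep_batch (W := fun _ : Finset (Fin m) => w)
          fun _ => hwc)).exp
        (integrable_exp_comp_of_integrable_exp_norm (hXm (n + 1)) (hX (n + 1) K) hφ)).2
      refine h.trans (integral_congr_ae (Filter.Eventually.of_forall fun ω => ?_))
      simp only
      rw [map_noiseNow hn, integral_fun_fst (fun e => Real.exp (φ (diagStep f c N η s (w (X n ω))
        (X n ω) e)))]
      simp only [probReal_univ, one_smul]
      exact (Real.exp_log (integral_exp_comp_diagStep_pos hc hs.le hK hφ _ _)).symm
    have hYI := integrable_comp_of_integrable_norm (hYm (n + 1)) (hY (n + 1)) hφ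
    have hg : Measurable fun p : H × ((Fin (N + 1) → ℝ) × Finset (Fin m)) =>
        φ (diagStep f c N η s (W p.2.2 p.1) p.1 p.2.1) := hφm.comp (measurable_diagStep_batch hW)
    have hYint := integral_comp_of_indepFun (hYm n) hVm hYind hg hYI
    have hψY := integrable_comp_of_integrable_norm (hYm n) (hY n) hψ
    -- One step of `Y` from a frozen state: the entropy bound for each minibatch, then the average
    -- over minibatches.
    have hstep : ∀ y, ∫ v, φ (diagStep f c N η s (W v.2 y) y v.1) ∂P.map (noiseNow N ε I n) ≤
        ψ y + (η / s) ^ 2 / 2 * V := by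
      intro y
      rw [map_noiseNow hn]
      have hi : Integrable (fun v : (Fin (N + 1) → ℝ) × Finset (Fin m) =>
          φ (diagStep f c N η s (W v.2 y) y v.1))
          ((stdGauss (Fin (N + 1))).prod (P.map (I n))) := by
        refine (integrable_prod_iff'
          (hg.comp (measurable_prodMk_left (x := y))).aestronglyMeasurable).2 ⟨Filter.Eventually.of_forall fun J =>
          integrable_comp_diagStep hc hs.le hK hφ (W J y) y, Integrable.of_finite⟩
      rw [integral_prod_symm _ hi]
      calc ∫ J, ∫ e, φ (diagStep f c N η s (W J y) y e) ∂stdGauss (Fin (N + 1)) ∂P.map (I n)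
          ≤ ∫ J, (ψ y + (η / s) ^ 2 / 2 * ‖w y - W J y‖ ^ 2) ∂P.map (I n) :=
            integral_mono Integrable.of_finite Integrable.of_finite fun J =>
              integral_comp_diagStep_le hc hs hK hφ w (W J y) y
        _ = ψ y + (η / s) ^ 2 / 2 * ∫ J, ‖w y - W J y‖ ^ 2 ∂P.map (I n) := by
            rw [integral_add (integrable_const _) Integrable.of_finite, integral_const_mul]
            simp
        _ ≤ ψ y + (η / s) ^ 2 / 2 * V := by
            gcongr
            exact hV n y
    calc ∫ ω, φ (Y (n + 1) ω) ∂P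
        = ∫ ω, ∫ v, φ (diagStep f c N η s (W v.2 (Y n ω)) (Y n ω) v.1)
            ∂P.map (noiseNow N ε I n) ∂P := hYint.2
      _ ≤ ∫ ω, (ψ (Y n ω) + (η / s) ^ 2 / 2 * V) ∂P :=
          integral_mono hYint.1 (hψY.add (integrable_const _)) fun ω => hstep (Y n ω)
      _ = ∫ ω, ψ (Y n ω) ∂P + (η / s) ^ 2 / 2 * V := by
          rw [integral_add hψY (integrable_const _)]
          simp
      _ ≤ Real.log (∫ ω, Real.exp (ψ (X n ω)) ∂P) + n * ((η / s) ^ 2 / 2 * V) +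
            (η / s) ^ 2 / 2 * V := by
          gcongr
          exact ih _ ψ hK' hψ
      _ = Real.log (∫ ω, Real.exp (φ (X (n + 1) ω)) ∂P) +
            (n + 1 : ℕ) * ((η / s) ^ 2 / 2 * V) := by
          rw [hXint]
          push_cast
          ring

end Entropy

/-! ### Small-parameter Laplace transforms and optimization in the parameter. -/

section Laplace

variable {Ω : Type*} [MeasurableSpace Ω] {P : Measure Ω} [IsProbabilityMeasure P]

theorem exp_mul_le_quadratic {t : ℝ} (ht0 : 0 ≤ t) (ht1 : t ≤ 1) (z : ℝ) :
    Real.exp (t * z) ≤ 1 + t * z + 2 * t ^ 2 * Real.exp (2 * |z|) := by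
  have h1 : |Real.exp (t * z) - (1 + t * z)| ≤ |t * z| ^ 2 * Real.exp |t * z| := by
    have h := Complex.norm_exp_sub_sum_le_norm_mul_exp ((t * z : ℝ) : ℂ) 2
    simp only [Finset.sum_range_succ, Finset.sum_range_zero] at h
    norm_num at h
    have e : Complex.exp (t * z) - (1 + t * z) = ((Real.exp (t * z) - (1 + t * z) : ℝ) : ℂ) := by
      push_cast; ring
    rw [e, Complex.norm_real, Real.norm_eq_abs, ← abs_mul, sq_abs] at h
    rwa [sq_abs]
  have h2 : |t * z| ≤ |z| := by
    rw [abs_mul, abs_of_nonneg ht0]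
    exact mul_le_of_le_one_left (abs_nonneg z) ht1
  have h3 : z ^ 2 ≤ 2 * Real.exp |z| := by
    have := Real.quadratic_le_exp_of_nonneg (abs_nonneg z)
    rw [sq_abs] at this
    nlinarith [abs_nonneg z]
  have h4 : |t * z| ^ 2 * Real.exp |t * z| ≤ 2 * t ^ 2 * Real.exp (2 * |z|) := by
    calc |t * z| ^ 2 * Real.exp |t * z| ≤ |t * z| ^ 2 * Real.exp |z| := by gcongr
      _ = t ^ 2 * z ^ 2 * Real.exp |z| := by rw [sq_abs, mul_pow]
      _ ≤ t ^ 2 * (2 * Real.exp |z|) * Real.exp |z| := by gcongr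
      _ = 2 * t ^ 2 * Real.exp (2 * |z|) := by rw [two_mul |z|, Real.exp_add]; ring
  linarith [(abs_le.1 h1).2]

/-- `Z` is centred, so the linear Taylor term integrates to zero; then `log x ≤ x - 1`. -/
theorem log_integral_exp_mul_le {Z : Ω → ℝ} (hZm : Measurable Z) (hZ : Integrable Z P)
    (hZ0 : ∫ ω, Z ω ∂P = 0) {Q : ℝ} (hE : Integrable (fun ω => Real.exp (2 * |Z ω|)) P)
    (hQ : ∫ ω, Real.exp (2 * |Z ω|) ∂P ≤ Q) {t : ℝ} (ht0 : 0 ≤ t) (ht1 : t ≤ 1) :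
    Real.log (∫ ω, Real.exp (t * Z ω) ∂P) ≤ 2 * Q * t ^ 2 := by
  have hi : Integrable (fun ω => Real.exp (t * Z ω)) P := by
    refine hE.mono' (hZm.const_mul t).exp.aestronglyMeasurable
      (Filter.Eventually.of_forall fun ω => ?_)
    rw [Real.norm_eq_abs, Real.abs_exp, Real.exp_le_exp]
    nlinarith [le_abs_self (Z ω), abs_nonneg (Z ω), mul_le_of_le_one_left (abs_nonneg (Z ω)) ht1]
  have hpos : 0 < ∫ ω, Real.exp (t * Z ω) ∂P := integral_exp_pos hi
  have h1 : Integrable (fun ω => 1 + t * Z ω) P := (integrable_const _).add (hZ.const_mul t)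
  have h2 : Integrable (fun ω => 2 * t ^ 2 * Real.exp (2 * |Z ω|)) P := hE.const_mul _
  have h3 := integral_mono hi (h1.add h2) fun ω => exp_mul_le_quadratic ht0 ht1 (Z ω)
  have h4 : ∫ ω, (1 + t * Z ω + 2 * t ^ 2 * Real.exp (2 * |Z ω|)) ∂P =
      1 + 2 * t ^ 2 * ∫ ω, Real.exp (2 * |Z ω|) ∂P := by
    rw [integral_add h1 h2, integral_add (integrable_const _) (hZ.const_mul t),
      integral_const_mul, integral_const_mul, hZ0]
    simp
  have h5 := Real.log_le_sub_one_of_pos hpos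
  have h6 : 2 * t ^ 2 * ∫ ω, Real.exp (2 * |Z ω|) ∂P ≤ 2 * t ^ 2 * Q := by gcongr
  have h7 : ∫ ω, Real.exp (t * Z ω) ∂P ≤ 1 + 2 * t ^ 2 * ∫ ω, Real.exp (2 * |Z ω|) ∂P :=
    h3.trans_eq h4
  linarith

/-- For `0 < q ≤ 1` take `t = √q`. For `q > 1` that choice is not allowed and the a priori bound `d
≤ D` suffices. For `q = 0` a small `t` excludes `d > 0`. -/
theorem le_mul_sqrt_of_forall_mul_le {d a D q : ℝ} (ha : 0 ≤ a) (hD : 0 ≤ D) (hq : 0 ≤ q)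
    (hd : d ≤ D) (h : ∀ t, 0 < t → t ≤ 1 → t * d ≤ a * t ^ 2 + q) :
    d ≤ (a + D + 1) * Real.sqrt q := by
  rcases hq.eq_or_lt with rfl | hq0
  · rw [Real.sqrt_zero, mul_zero]
    by_contra! hd0
    have h1 := h (min 1 (d / (2 * (a + 1)))) (by positivity) (min_le_left _ _)
    set t := min 1 (d / (2 * (a + 1)))
    have ht : 0 < t := by positivity
    have ht2 : t ≤ d / (2 * (a + 1)) := min_le_right _ _
    rw [le_div_iff₀ (by positivity)] at ht2
    nlinarith
  · have hs := Real.sqrt_pos.2 hq0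
    rcases le_or_gt q 1 with h1 | h1
    · have h2 := h (Real.sqrt q) hs (Real.sqrt_le_one.2 h1)
      rw [Real.sq_sqrt hq] at h2
      have h3 : Real.sqrt q * d ≤ Real.sqrt q * ((a + 1) * Real.sqrt q) := by
        nlinarith [Real.mul_self_sqrt hq]
      have h4 := le_of_mul_le_mul_left h3 hs
      nlinarith
    · have h2 : 1 ≤ Real.sqrt q := Real.one_le_sqrt.2 h1.le
      nlinarith

end Laplace

/-! ### Exponential moments of bounded perturbations of a Gaussian chain. -/

section NormMoments

variable {H : Type*} [NormedAddCommGroup H] [MeasurableSpace H] [BorelSpace H] {Ω : Type*}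
  [MeasurableSpace Ω] {P : Measure Ω}

/-- Bound for `E exp (a ‖G‖)` when `E exp (δ ‖G‖ ^ 2) ≤ gaussExpSq`. -/
noncomputable def expNormConst (δ a : ℝ) : ℝ := Real.exp (a ^ 2 / (4 * δ)) * gaussExpSq

theorem expNormConst_nonneg (δ a : ℝ) : 0 ≤ expNormConst δ a :=
  mul_nonneg (Real.exp_pos _).le gaussExpSq_nonneg

/-- Young's inequality: `a * ‖G‖ ≤ a ^ 2 / (4 * δ) + δ * ‖G‖ ^ 2`. -/
theorem exp_norm_moment {G : Ω → H} (hG : Measurable G) {δ : ℝ} (hδ : 0 < δ)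
    (hi : Integrable (fun ω => Real.exp (δ * ‖G ω‖ ^ 2)) P)
    (hle : ∫ ω, Real.exp (δ * ‖G ω‖ ^ 2) ∂P ≤ gaussExpSq) (a : ℝ) :
    Integrable (fun ω => Real.exp (a * ‖G ω‖)) P ∧
      ∫ ω, Real.exp (a * ‖G ω‖) ∂P ≤ expNormConst δ a := by
  have h : ∀ ω, Real.exp (a * ‖G ω‖) ≤
      Real.exp (a ^ 2 / (4 * δ)) * Real.exp (δ * ‖G ω‖ ^ 2) := fun ω => by
    rw [← Real.exp_add, Real.exp_le_exp]
    have : a ^ 2 / (4 * δ) + δ * ‖G ω‖ ^ 2 - a * ‖G ω‖ = (a - 2 * δ * ‖G ω‖) ^ 2 / (4 * δ) := by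
      field_simp
      ring
    have h2 : 0 ≤ (a - 2 * δ * ‖G ω‖) ^ 2 / (4 * δ) := by positivity
    linarith
  have hi' : Integrable (fun ω => Real.exp (a * ‖G ω‖)) P :=
    (hi.const_mul _).mono' (hG.norm.const_mul a).exp.aestronglyMeasurable
      (Filter.Eventually.of_forall fun ω => by
        rw [Real.norm_eq_abs, Real.abs_exp]; exact h ω)
  refine ⟨hi', (integral_mono hi' (hi.const_mul _) h).trans ?_⟩
  rw [integral_const_mul]
  exact mul_le_mul_of_nonneg_left hle (Real.exp_pos _).le

theorem integrable_exp_norm_of_norm_sub_le {X G : Ω → H} (hX : Measurable X) {R : ℝ}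
    (hXG : ∀ᵐ ω ∂P, ‖X ω - G ω‖ ≤ R)
    (hG : ∀ a, Integrable (fun ω => Real.exp (a * ‖G ω‖)) P) (a : ℝ) :
    Integrable (fun ω => Real.exp (a * ‖X ω‖)) P := by
  refine ((hG |a|).const_mul (Real.exp (|a| * R))).mono'
    (hX.norm.const_mul a).exp.aestronglyMeasurable ?_
  filter_upwards [hXG] with ω hω
  rw [Real.norm_eq_abs, Real.abs_exp, ← Real.exp_add, Real.exp_le_exp]
  have h1 : ‖X ω‖ ≤ R + ‖G ω‖ := by
    have := norm_add_le (X ω - G ω) (G ω)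
    rw [sub_add_cancel] at this
    linarith
  nlinarith [le_abs_self a, norm_nonneg (X ω), abs_nonneg a,
    mul_le_mul_of_nonneg_left h1 (abs_nonneg a),
    mul_le_mul_of_nonneg_right (le_abs_self a) (norm_nonneg (X ω))]

theorem integrable_norm_of_integrable_exp {X : Ω → H} (hX : Measurable X)
    (h : Integrable (fun ω => Real.exp (1 * ‖X ω‖)) P) : Integrable (fun ω => ‖X ω‖) P := by
  refine h.mono' hX.norm.aestronglyMeasurable (Filter.Eventually.of_forall fun ω => ?_)
  rw [norm_norm, one_mul]
  linarith [Real.add_one_le_exp ‖X ω‖]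

/-- Bound for the exponential moment `E exp (2 |φ(X) - E φ(X)|)` of `1`-Lipschitz functions. -/
noncomputable def laplaceConst (R δ : ℝ) : ℝ :=
  Real.exp (4 * R + 2 * expNormConst δ 1) * expNormConst δ 2

variable [IsProbabilityMeasure P]

/-- Both `φ (X ω)` and its mean are compared with `φ 0`, at distance at most `R + ‖G ω‖` and `R + E
‖G‖`; doubling the sum gives the `4 * R` and `2 * expNormConst δ 1` in `laplaceConst`. -/
theorem exp_abs_sub_integral_moment {X G : Ω → H} (hX : Measurable X) (hG : Measurable G) {R δ : ℝ}
    (hδ : 0 < δ) (hXG : ∀ᵐ ω ∂P, ‖X ω - G ω‖ ≤ R)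
    (hi : Integrable (fun ω => Real.exp (δ * ‖G ω‖ ^ 2)) P)
    (hle : ∫ ω, Real.exp (δ * ‖G ω‖ ^ 2) ∂P ≤ gaussExpSq) {φ : H → ℝ}
    (hφ : ∀ x y, |φ x - φ y| ≤ 1 * ‖x - y‖) :
    Integrable (fun ω => Real.exp (2 * |φ (X ω) - ∫ ω', φ (X ω') ∂P|)) P ∧
      ∫ ω, Real.exp (2 * |φ (X ω) - ∫ ω', φ (X ω') ∂P|) ∂P ≤ laplaceConst R δ := by
  have hGm := exp_norm_moment hG hδ hi hle
  have hXm := integrable_exp_norm_of_norm_sub_le hX hXG fun a => (hGm a).1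
  have hGn := integrable_norm_of_integrable_exp hG (hGm 1).1
  have hφX := integrable_comp_of_integrable_norm hX
    (integrable_norm_of_integrable_exp hX (hXm 1)) hφ
  have hGE : ∫ ω, ‖G ω‖ ∂P ≤ expNormConst δ 1 := by
    refine (integral_mono hGn (hGm 1).1 fun ω => ?_).trans (hGm 1).2
    simp only [one_mul]
    linarith [Real.add_one_le_exp ‖G ω‖]
  have h0 : ∀ᵐ ω ∂P, |φ (X ω) - φ 0| ≤ R + ‖G ω‖ := by
    filter_upwards [hXG] with ω hω
    have h1 := hφ (X ω) 0
    have h2 := norm_add_le (X ω - G ω) (G ω)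
    rw [sub_add_cancel] at h2
    rw [sub_zero] at h1
    linarith
  have hmean : |φ 0 - ∫ ω, φ (X ω) ∂P| ≤ R + expNormConst δ 1 := by
    have e : φ 0 - ∫ ω, φ (X ω) ∂P = -∫ ω, (φ (X ω) - φ 0) ∂P := by
      rw [integral_sub hφX (integrable_const _)]
      simp
    rw [e, abs_neg]
    refine (abs_integral_le_integral_abs).trans ?_
    refine (integral_mono_ae (hφX.sub (integrable_const _)).abs
      ((integrable_const R).add hGn) h0).trans ?_
    simp only [Pi.add_apply]
    rw [integral_add (integrable_const _) hGn]
    simpa using hGE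
  have hb : ∀ᵐ ω ∂P, Real.exp (2 * |φ (X ω) - ∫ ω', φ (X ω') ∂P|) ≤
      Real.exp (4 * R + 2 * expNormConst δ 1) * Real.exp (2 * ‖G ω‖) := by
    filter_upwards [h0] with ω hω
    rw [← Real.exp_add, Real.exp_le_exp]
    have := abs_sub_le (φ (X ω)) (φ 0) (∫ ω', φ (X ω') ∂P)
    linarith
  have hint : Integrable (fun ω => Real.exp (2 * |φ (X ω) - ∫ ω', φ (X ω') ∂P|)) P := by
    refine ((hGm 2).1.const_mul (Real.exp (4 * R + 2 * expNormConst δ 1))).mono' ?_ (hb.mono fun ω h => ?_)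
    · exact (((((continuous_of_abs_sub_le hφ).measurable.comp hX).sub_const _).abs).const_mul
        2).exp.aestronglyMeasurable
    · rw [Real.norm_eq_abs, Real.abs_exp]
      exact h
  refine ⟨hint, (integral_mono_ae hint ((hGm 2).1.const_mul _) hb).trans ?_⟩
  rw [integral_const_mul]
  exact mul_le_mul_of_nonneg_left (hGm 2).2 (Real.exp_pos _).le

end NormMoments

/-! ### The square-root comparison of two chains. -/

section Comparison

variable {H : Type*} [NormedAddCommGroup H] [InnerProductSpace ℝ H] [MeasurableSpace H]
  [BorelSpace H] {Ω : Type*} [MeasurableSpace Ω] {P : Measure Ω} [IsProbabilityMeasure P]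

variable {m b : ℕ} {ε : ℕ → ℕ → Ω → ℝ} {I : ℕ → Ω → Finset (Fin m)}
  {f : HilbertBasis ℕ ℝ H} {μ : ℕ → ℝ} {lam η s B Lw V : ℝ} {N : ℕ}
  {w : H → H} {W : Finset (Fin m) → H → H} {x₀ : H}

/-- Constant in the comparison of two Langevin chains. -/
noncomputable def comparisonConst (R δ : ℝ) : ℝ := 2 * laplaceConst R δ + 2 * R + 1

theorem laplaceConst_nonneg (R δ : ℝ) : 0 ≤ laplaceConst R δ :=
  mul_nonneg (Real.exp_pos _).le (expNormConst_nonneg _ _)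

/-- Weak comparison of a Langevin chain with drift `w` and one with random drift `W`. -/
theorem abs_integral_langevinChain_sub_le (hn : IsNoise P b ε I) (hbm : b ≤ m)
    (hanti : Antitone μ) (hμ : ∀ k, 0 ≤ μ k)
    (hlam : 0 < lam) (hη : 0 < η) (hs : 0 < s) (hs2 : s ^ 2 ≤ 2 * η) {τ : ℕ → ℝ}
    (hτ : ∀ k, 0 < τ k) (hμτ : ∀ k, μ k ≤ τ k) (hsum : Summable τ) (hB : 0 ≤ B)
    (hLw : 0 ≤ Lw) (hw : ∀ x y, ‖w x - w y‖ ≤ Lw * ‖x - y‖) (hwB : ∀ x, ‖w x‖ ≤ B)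
    (hW : ∀ J, Continuous (W J)) (hWB : ∀ J : Finset (Fin m), J.card = b → ∀ x, ‖W J x‖ ≤ B)
    (hV0 : 0 ≤ V) (hV : ∀ n y, ∫ J, ‖w y - W J y‖ ^ 2 ∂P.map (I n) ≤ V) (hx₀ : ‖x₀‖ ≤ 1) (n : ℕ)
    {K : ℝ} (hK : 0 ≤ K) {φ : H → ℝ} (hφ : ∀ x y, |φ x - φ y| ≤ K * ‖x - y‖) {X Y : Ω → H}
    (hXdef : X = langevinChain f (resolventCoeff μ lam η) N η s (fun _ => w) x₀ ε I n)
    (hYdef : Y = langevinChain f (resolventCoeff μ lam η) N η s W x₀ ε I n) :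
    Integrable (fun ω => φ (X ω)) P ∧ Integrable (fun ω => φ (Y ω)) P ∧
      |∫ ω, (φ (X ω) - φ (Y ω)) ∂P| ≤
        K * (comparisonConst (1 + B * μ 0 / lam) (lam / (4 * ∑' k, τ k)) *
          Real.sqrt (n * ((η / s) ^ 2 / 2 * V))) := by
  set c := resolventCoeff μ lam η
  set R := 1 + B * μ 0 / lam with hR
  set δ := lam / (4 * ∑' k, τ k) with hδdef
  have hS : 0 < ∑' k, τ k := hsum.tsum_pos (fun k => (hτ k).le) 0 (hτ 0)
  have hδ : 0 < δ := by positivity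
  have hμ0 := hμ 0
  have hR0 : 0 ≤ R := by positivity
  have hR1 : 1 ≤ R := by rw [hR]; linarith [show 0 ≤ B * μ 0 / lam by positivity]
  have hc := abs_resolventCoeff_le hanti hμ hlam hη
  have hρR := resolventCoeff_mul_radius_le (B := B) hμ hlam hη
  have hwc : Continuous w := continuous_of_norm_sub_le hw
  set XX := langevinChain f c N η s (fun _ : Finset (Fin m) => w) x₀ ε I
  set YY := langevinChain f c N η s W x₀ ε I
  set GG := gaussChain f c N η s ε I
  have hXm : ∀ n, Measurable (XX n) := measurable_langevinChain f hn (fun _ => hwc) x₀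
  have hYm : ∀ n, Measurable (YY n) := measurable_langevinChain f hn hW x₀
  have hGm : ∀ n, Measurable (GG n) :=
    measurable_langevinChain f hn (fun _ => continuous_const) 0
  have hXG : ∀ n, ∀ᵐ ω ∂P, ‖XX n ω - GG n ω‖ ≤ R := fun n =>
    Filter.Eventually.of_forall fun ω =>
      norm_langevinChain_sub_le hc hη.le hρR (hx₀.trans hR1) (fun _ x => hwB x) n
  have hYG : ∀ n, ∀ᵐ ω ∂P, ‖YY n ω - GG n ω‖ ≤ R := fun n => by
    -- The random drift is bounded by `B` only for minibatches of size `b`, hence the bound is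
    -- almost sure.
    filter_upwards [ae_all_iff.2 fun j => ae_card_batch hn hbm j] with ω hω
    exact norm_langevinChain_sub_le hc hη.le hρR (hx₀.trans hR1)
      (fun j x => hWB _ (hω j) x) n
  have hGmom := fun n => exp_sq_moment_gaussChain (s := s) (N := N) f hn hμ hlam hη hs2 hτ hμτ hsum n
  have hGexp := fun n => exp_norm_moment (hGm n) hδ (hGmom n).1 (hGmom n).2
  have hXexp := fun n => integrable_exp_norm_of_norm_sub_le (hXm n) (hXG n) fun a => (hGexp n a).1
  have hYexp := fun n => integrable_exp_norm_of_norm_sub_le (hYm n) (hYG n) fun a => (hGexp n a).1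
  have hXn := fun n => integrable_norm_of_integrable_exp (hXm n) (hXexp n 1)
  have hYn := fun n => integrable_norm_of_integrable_exp (hYm n) (hYexp n 1)
  set q := n * ((η / s) ^ 2 / 2 * V) with hq
  have hq0 : 0 ≤ q := by positivity
  have one_sided : ∀ φ : H → ℝ, (∀ x y, |φ x - φ y| ≤ 1 * ‖x - y‖) →
      ∫ ω, φ (YY n ω) ∂P - ∫ ω, φ (XX n ω) ∂P ≤ comparisonConst R δ * Real.sqrt q := by
    intro φ hφ
    have hφX := integrable_comp_of_integrable_norm (hXm n) (hXn n) hφ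
    have hφY := integrable_comp_of_integrable_norm (hYm n) (hYn n) hφ
    have hmom := exp_abs_sub_integral_moment (hXm n) (hGm n) hδ (hXG n) (hGmom n).1 (hGmom n).2 hφ
    refine le_mul_sqrt_of_forall_mul_le (mul_nonneg zero_le_two (laplaceConst_nonneg R δ))
      (by positivity) hq0 ?_ fun t ht0 ht1 => ?_
    · rw [← integral_sub hφY hφX]
      -- A priori bound: both chains lie within `R` of the same Gaussian chain.
      have h : ∀ᵐ ω ∂P, φ (YY n ω) - φ (XX n ω) ≤ 2 * R := by
        filter_upwards [hXG n, hYG n] with ω h1 h2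
        have h3 := (abs_le.1 (hφ (YY n ω) (XX n ω))).2
        have h4 : ‖YY n ω - XX n ω‖ ≤ ‖YY n ω - GG n ω‖ + ‖XX n ω - GG n ω‖ := by
          rw [← sub_sub_sub_cancel_right (YY n ω) (XX n ω) (GG n ω)]
          exact norm_sub_le _ _
        linarith
      refine (integral_mono_ae (hφY.sub hφX) (integrable_const (2 * R)) h).trans ?_
      simp
    · set e := ∫ ω, φ (XX n ω) ∂P with he
      have hψ : ∀ x y, |t * (φ x - e) - t * (φ y - e)| ≤ t * ‖x - y‖ := fun x y => by
        rw [← mul_sub, sub_sub_sub_cancel_right, abs_mul, abs_of_pos ht0]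
        have := hφ x y
        rw [one_mul] at this
        gcongr
      have h := integral_langevinChain_le_log_integral_exp hn hc hη.le hs hLw hw hW hV x₀ hXexp
        hYn n t (fun x => t * (φ x - e)) ht0.le hψ
      have hlog := log_integral_exp_mul_le
        (((continuous_of_abs_sub_le hφ).measurable.comp (hXm n)).sub_const e)
        (hφX.sub (integrable_const e)) (by
          simp only [Function.comp]
          rw [integral_sub hφX (integrable_const _)]
          simp [he]) hmom.1 hmom.2 ht0.le ht1
      simp only [Function.comp] at hlog
      rw [integral_const_mul, integral_sub hφY (integrable_const _)] at h
      simp only [integral_const, probReal_univ, one_smul] at h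
      exact h.trans (add_le_add hlog le_rfl)
  have hφX := integrable_comp_of_integrable_norm (hXm n) (hXn n) hφ
  have hφY := integrable_comp_of_integrable_norm (hYm n) (hYn n) hφ
  subst hXdef hYdef
  refine ⟨hφX, hφY, ?_⟩
  rcases hK.eq_or_lt with rfl | hK0
  · have h : ∀ x y, φ x - φ y = 0 := fun x y => by
      have := hφ x y
      rw [zero_mul] at this
      exact abs_nonpos_iff.1 this
    simp [h]
  -- Normalizing to Lipschitz constant one makes the bound linear in `K`; the two signs give the
  -- absolute value.
  · have hscale : ∀ σ : ℝ, |σ| = 1 → ∀ x y, |σ / K * φ x - σ / K * φ y| ≤ 1 * ‖x - y‖ := by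
      intro σ hσ x y
      rw [← mul_sub, abs_mul, abs_div, hσ, abs_of_pos hK0, one_mul, one_div, inv_mul_le_iff₀ hK0]
      exact hφ x y
    have h1 := one_sided _ (hscale 1 (by simp))
    have h2 := one_sided _ (hscale (-1) (by simp))
    rw [integral_const_mul, integral_const_mul, ← mul_sub, div_mul_eq_mul_div, div_le_iff₀ hK0]
      at h1 h2
    rw [integral_sub hφX hφY, abs_le]
    constructor <;> linarith

end Comparison

/-! ### The Galerkin iterates as Langevin chains. -/

section Galerkin

variable {H : Type*} [NormedAddCommGroup H] [InnerProductSpace ℝ H] {f : HilbertBasis ℕ ℝ H}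
  {N : ℕ}

theorem galerkinProj_eq_sum_fin (f : HilbertBasis ℕ ℝ H) (N : ℕ) (x : H) :
    galerkinProj f N x = ∑ k : Fin (N + 1), (1 * ⟪f k, x⟫) • f k := by
  simp only [one_mul]
  exact Finset.sum_range (fun k => ⟪f k, x⟫ • f k)

theorem galerkinProj_sub (x y : H) :
    galerkinProj f N (x - y) = galerkinProj f N x - galerkinProj f N y := by
  simp [galerkinProj, inner_sub_right, sub_smul, Finset.sum_sub_distrib]

theorem galerkinProj_add (x y : H) :
    galerkinProj f N (x + y) = galerkinProj f N x + galerkinProj f N y := by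
  simp [galerkinProj, inner_add_right, add_smul, Finset.sum_add_distrib]

theorem galerkinProj_smul (a : ℝ) (x : H) :
    galerkinProj f N (a • x) = a • galerkinProj f N x := by
  simp [galerkinProj, inner_smul_right, mul_smul, Finset.smul_sum]

theorem norm_galerkinProj_le (x : H) : ‖galerkinProj f N x‖ ≤ ‖x‖ := by
  rw [galerkinProj_eq_sum_fin]
  have := norm_sum_mul_inner_le (f := f) (N := N) (c := fun _ => 1) (ρ := 1) (by simp) x
  rwa [one_mul] at this

theorem inner_galerkinProj (x : H) (k : ℕ) :
    ⟪f k, galerkinProj f N x⟫ = if k ∈ Finset.range (N + 1) then ⟪f k, x⟫ else 0 := by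
  have h := orthonormal_iff_ite.1 f.orthonormal
  simp only [galerkinProj, inner_sum, inner_smul_right, h]
  simp

theorem galerkinProj_sum_basis (a : Fin (N + 1) → ℝ) :
    galerkinProj f N (∑ k, a k • f k) = ∑ k, a k • f k := by
  rw [galerkinProj_eq_sum_fin]
  exact Finset.sum_congr rfl fun k _ => by rw [inner_sum_basis, one_mul]

theorem galerkinProj_galerkinProj (x : H) :
    galerkinProj f N (galerkinProj f N x) = galerkinProj f N x := by
  conv_lhs => rw [galerkinProj_eq_sum_fin f N x, galerkinProj_sum_basis]
  rw [← galerkinProj_eq_sum_fin]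

theorem resolventS_galerkinProj (μ : ℕ → ℝ) (lam η : ℝ) (x : H) :
    resolventS f μ lam η (galerkinProj f N x) =
      ∑ k : Fin (N + 1), (resolventCoeff μ lam η k * ⟪f k, x⟫) • f k := by
  rw [resolventS, tsum_eq_sum (s := Finset.range (N + 1)) fun k hk => by
    rw [inner_galerkinProj, if_neg hk, mul_zero, zero_smul]]
  rw [Finset.sum_range]
  refine Finset.sum_congr rfl fun k _ => ?_
  rw [inner_galerkinProj, if_pos (by simpa using k.is_le)]
  rfl

/-- A Galerkin Langevin step is a diagonal step. -/
theorem resolventS_step_eq_diagStep {Ω : Type*} (μ : ℕ → ℝ) (lam η s : ℝ)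
    (ε : ℕ → ℕ → Ω → ℝ) (n : ℕ) (ω : Ω) (w : H) {x : H} (hx : galerkinProj f N x = x) :
    resolventS f μ lam η (x - η • galerkinProj f N w + s • projNoise f N ε n ω) =
      diagStep f (resolventCoeff μ lam η) N η s w x fun k => ε n k ω := by
  have hnoise : projNoise f N ε n ω = ∑ k : Fin (N + 1), ε n k ω • f k :=
    Finset.sum_range (fun k => ε n k ω • f k)
  have h : x - η • galerkinProj f N w + s • projNoise f N ε n ω =
      galerkinProj f N (x - η • w + s • projNoise f N ε n ω) := by
    rw [galerkinProj_add, galerkinProj_sub, galerkinProj_smul, galerkinProj_smul, hx, hnoise,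
      galerkinProj_sum_basis]
  rw [h, resolventS_galerkinProj]
  refine Finset.sum_congr rfl fun k _ => ?_
  rw [inner_add_right, inner_smul_right (f k) (projNoise f N ε n ω), hnoise, inner_sum_basis]

theorem galerkinProj_diagStep {c : ℕ → ℝ} {η s : ℝ} (w x : H) (e : Fin (N + 1) → ℝ) :
    galerkinProj f N (diagStep f c N η s w x e) = diagStep f c N η s w x e :=
  galerkinProj_sum_basis _

theorem galerkinProj_langevinChain {Ω : Type*} {m : ℕ} {c : ℕ → ℝ} {η s : ℝ}
    {W : Finset (Fin m) → H → H} {x₀ : H} {ε : ℕ → ℕ → Ω → ℝ} {I : ℕ → Ω → Finset (Fin m)}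
    (n : ℕ) (ω : Ω) :
    galerkinProj f N (langevinChain f c N η s W (galerkinProj f N x₀) ε I n ω) =
      langevinChain f c N η s W (galerkinProj f N x₀) ε I n ω := by
  cases n with
  | zero => exact galerkinProj_galerkinProj x₀
  | succ n => exact galerkinProj_diagStep _ _ _

theorem norm_mean_le {ι : Type*} {J : Finset ι} {b : ℕ} (hJ : J.card = b) (hb : 1 ≤ b)
    (g : ι → H) {D : ℝ} (hg : ∀ i, ‖g i‖ ≤ D) : ‖(1 / (b : ℝ)) • ∑ i ∈ J, g i‖ ≤ D := by
  have hb0 : (0 : ℝ) < b := by exact_mod_cast hb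
  rw [norm_smul, Real.norm_eq_abs, abs_of_pos (by positivity), one_div, inv_mul_le_iff₀ hb0]
  refine (norm_sum_le_of_le J fun i _ => hg i).trans ?_
  rw [Finset.sum_const, hJ, nsmul_eq_mul]

variable [CompleteSpace H]

theorem galerkinSGLD_eq_langevinChain {Ω : Type*} {m : ℕ} (μ : ℕ → ℝ) (lam β η : ℝ) (b : ℕ)
    (l : Fin m → H → ℝ) (x₀ : H) (ε : ℕ → ℕ → Ω → ℝ) (I : ℕ → Ω → Finset (Fin m)) (n : ℕ) :
    galerkinSGLD f μ lam β η N b l x₀ ε I n =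
      langevinChain f (resolventCoeff μ lam η) N η (Real.sqrt (2 * (η / β)))
        (fun J x => batchGradient l b J (galerkinProj f N x)) (galerkinProj f N x₀) ε I n := by
  induction n with
  | zero => rfl
  | succ n ih =>
    ext ω
    simp only [galerkinSGLD, langevinChain, ih]
    exact resolventS_step_eq_diagStep μ lam η _ ε n ω _ (galerkinProj_langevinChain n ω)

/-- The full-gradient drift ignores the minibatch, so any `I` may be inserted; this puts both
dynamics on one filtration. -/
theorem galerkinGLD_eq_langevinChain {Ω : Type*} {m : ℕ} (μ : ℕ → ℝ) (lam β η : ℝ)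
    (l : Fin m → H → ℝ) (x₀ : H) (ε : ℕ → ℕ → Ω → ℝ) (I : ℕ → Ω → Finset (Fin m)) (n : ℕ) :
    galerkinGLD f μ lam β η N l x₀ ε n =
      langevinChain f (resolventCoeff μ lam η) N η (Real.sqrt (2 * (η / β)))
        (fun _ x => ∇ (empiricalRisk l) (galerkinProj f N x)) (galerkinProj f N x₀) ε I n := by
  induction n with
  | zero => rfl
  | succ n ih =>
    ext ω
    simp only [galerkinGLD, langevinChain, ih]
    exact resolventS_step_eq_diagStep μ lam η _ ε n ω _ (galerkinProj_langevinChain n ω)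

end Galerkin

/-! ### Gradients and Lipschitz bounds for the test functions. -/

section Gradients

variable {H : Type*} [NormedAddCommGroup H] [InnerProductSpace ℝ H] [CompleteSpace H] {m : ℕ}
  {l : Fin m → H → ℝ}

theorem hasGradientAt_empiricalRisk (hl : ∀ i, Differentiable ℝ (l i)) (x : H) :
    HasGradientAt (empiricalRisk l) ((1 / (m : ℝ)) • ∑ i, ∇ (l i) x) x := by
  rw [hasGradientAt_iff_hasFDerivAt]
  have h : HasFDerivAt (fun y => ∑ i, l i y)
      (∑ i, (InnerProductSpace.toDual ℝ H) (∇ (l i) x)) x :=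
    HasFDerivAt.fun_sum fun i _ => (hl i x).hasGradientAt.hasFDerivAt
  have h2 := h.const_mul (1 / (m : ℝ))
  rw [map_smul, map_sum]
  exact h2

theorem gradient_empiricalRisk (hl : ∀ i, Differentiable ℝ (l i)) (x : H) :
    ∇ (empiricalRisk l) x = (1 / (m : ℝ)) • ∑ i, ∇ (l i) x :=
  (hasGradientAt_empiricalRisk hl x).gradient

theorem abs_sub_le_of_norm_gradient_le {φ : H → ℝ} (hφ : Differentiable ℝ φ) {K : ℝ}
    (hK : ∀ x, ‖∇ φ x‖ ≤ K) (x y : H) : |φ x - φ y| ≤ K * ‖x - y‖ := by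
  refine Convex.norm_image_sub_le_of_norm_fderiv_le (𝕜 := ℝ) (s := Set.univ) (fun z _ => hφ z)
    (fun z _ => ?_) convex_univ (Set.mem_univ y) (Set.mem_univ x)
  have h := hK z
  rwa [gradient, LinearIsometryEquiv.norm_map] at h

theorem abs_sigmoidShifted_sub_le (u v : ℝ) :
    |sigmoidShifted u - sigmoidShifted v| ≤ |u - v| := by
  have h : ∀ u, sigmoidShifted u = Real.sigmoid u - 1 / 2 := fun u => by
    rw [sigmoidShifted, Real.sigmoid_def, one_div]
  rw [h, h, sub_sub_sub_cancel_right]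
  have := Convex.norm_image_sub_le_of_norm_deriv_le (𝕜 := ℝ) (f := Real.sigmoid) (C := 1)
    (s := Set.univ) (fun z _ => differentiable_sigmoid z) (fun z _ => ?_) convex_univ
    (Set.mem_univ v) (Set.mem_univ u)
  · simpa using this
  · rw [Real.deriv_sigmoid, Real.norm_eq_abs,
      abs_of_nonneg (mul_nonneg (Real.sigmoid_nonneg z) (by linarith [Real.sigmoid_le_one z]))]
    nlinarith [Real.sigmoid_nonneg z, Real.sigmoid_le_one z]

theorem norm_gradient_le_cb2Norm {φ : H → ℝ} (hφ : IsCb2 φ) (x : H) : ‖∇ φ x‖ ≤ cb2Norm φ :=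
  (le_ciSup hφ.2.2.1 x).trans ((le_max_left _ _).trans (le_max_right _ _))

end Gradients

/-! ### Summability of the eigenvalues. -/

section Decay

/-- A summable positive majorant of the eigenvalues. -/
theorem EigenvalueDecay.exists_summable_majorant {μ : ℕ → ℝ} (hμ : EigenvalueDecay μ) :
    ∃ τ : ℕ → ℝ, (∀ k, 0 < τ k) ∧ (∀ k, μ k ≤ τ k) ∧ Summable τ := by
  obtain ⟨-, -, c₁, -, c₂, hc₂, h⟩ := hμ
  refine ⟨fun k => c₂ / ((k : ℝ) + 1) ^ 2, fun k => by positivity, fun k => (h k).1, ?_⟩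
  have h1 := (summable_nat_add_iff 1).2 (Real.summable_one_div_nat_pow.2 one_lt_two)
  refine (h1.mul_left c₂).congr fun k => ?_
  push_cast
  ring

end Decay

/-! ### Weak error for Lipschitz test functions. -/

section Main

variable {H : Type*} [NormedAddCommGroup H] [InnerProductSpace ℝ H] [CompleteSpace H]

/-- Weak error between the Galerkin GLD and SGLD for Lipschitz test functions. -/
theorem abs_integral_galerkinGLD_sub_galerkinSGLD_le (f : HilbertBasis ℕ ℝ H) {μ : ℕ → ℝ}
    (hanti : Antitone μ) (hμ : ∀ k, 0 ≤ μ k) {lam : ℝ} (hlam : 0 < lam) {τ : ℕ → ℝ}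
    (hτ : ∀ k, 0 < τ k) (hμτ : ∀ k, μ k ≤ τ k) (hsum : Summable τ) {M B : ℝ} (hM : 0 ≤ M)
    (hB : 0 ≤ B) {m b : ℕ} (hm : 2 ≤ m) (hb : 1 ≤ b) (hbm : b ≤ m) {l : Fin m → H → ℝ}
    (hl : ∀ i, Differentiable ℝ (l i)) (hlM : ∀ i x y, ‖∇ (l i) x - ∇ (l i) y‖ ≤ M * ‖x - y‖)
    (hlB : ∀ i x, ‖∇ (l i) x‖ ≤ B) {x₀ : H} (hx₀ : ‖x₀‖ ≤ 1) (n N : ℕ) {β η : ℝ} (hβ : 1 < β)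
    (hη : 0 < η) {Ω : Type*} [MeasurableSpace Ω] {P : Measure Ω} [IsProbabilityMeasure P]
    {ε : ℕ → ℕ → Ω → ℝ} {I : ℕ → Ω → Finset (Fin m)} (hn : IsNoise P b ε I)
    {K : ℝ} (hK : 0 ≤ K) {φ : H → ℝ} (hφ : ∀ x y, |φ x - φ y| ≤ K * ‖x - y‖) {X Y : Ω → H}
    (hX : X = galerkinGLD f μ lam β η N l x₀ ε n)
    (hY : Y = galerkinSGLD f μ lam β η N b l x₀ ε I n) :
    Integrable (fun ω => φ (X ω)) P ∧ Integrable (fun ω => φ (Y ω)) P ∧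
      |∫ ω, (φ (X ω) - φ (Y ω)) ∂P| ≤
        K * (comparisonConst (1 + B * μ 0 / lam) (lam / (4 * ∑' k, τ k)) * B *
          Real.sqrt (discrepancyRate n m b β η)) := by
  let _ : MeasurableSpace H := borel H
  have : BorelSpace H := ⟨rfl⟩
  have hβ0 : 0 < β := one_pos.trans hβ
  have hm2 : (2 : ℝ) ≤ m := by exact_mod_cast hm
  have hb1 : (1 : ℝ) ≤ b := by exact_mod_cast hb
  have hbm' : (b : ℝ) ≤ m := by exact_mod_cast hbm
  set s := Real.sqrt (2 * (η / β)) with hsdef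
  have hs : 0 < s := Real.sqrt_pos.2 (by positivity)
  have hs2 : s ^ 2 = 2 * (η / β) := Real.sq_sqrt (by positivity)
  -- `β > 1` bounds the noise variance by `2 * η`, which makes the moment bounds uniform in `β`.
  have hs2' : s ^ 2 ≤ 2 * η := by
    rw [hs2]
    have := div_le_self hη.le hβ.le
    linarith
  have hproj : ∀ x y, ‖galerkinProj f N x - galerkinProj f N y‖ ≤ ‖x - y‖ := fun x y => by
    rw [← galerkinProj_sub]
    exact norm_galerkinProj_le _
  have hPc : Continuous (galerkinProj f N) :=
    continuous_of_norm_sub_le (M := 1) fun x y => by rw [one_mul]; exact hproj x y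
  have hw : ∀ x y, ‖∇ (empiricalRisk l) (galerkinProj f N x) -
      ∇ (empiricalRisk l) (galerkinProj f N y)‖ ≤ M * ‖x - y‖ := fun x y => by
    rw [gradient_empiricalRisk hl, gradient_empiricalRisk hl, ← smul_sub, ← Finset.sum_sub_distrib]
    refine norm_mean_le (by simp) (by omega) _ fun i => (hlM i _ _).trans ?_
    gcongr
    exact hproj x y
  have hwB : ∀ x, ‖∇ (empiricalRisk l) (galerkinProj f N x)‖ ≤ B := fun x => by
    rw [gradient_empiricalRisk hl]
    exact norm_mean_le (by simp) (by omega) _ fun i => hlB i _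
  have hgc : ∀ i, Continuous (∇ (l i)) := fun i => continuous_of_norm_sub_le (hlM i)
  have hW : ∀ J : Finset (Fin m), Continuous fun x => batchGradient l b J (galerkinProj f N x) :=
    fun J => (continuous_const.smul (continuous_finsetSum _ fun i _ => hgc i)).comp hPc
  have hWB : ∀ J : Finset (Fin m), J.card = b →
      ∀ x, ‖batchGradient l b J (galerkinProj f N x)‖ ≤ B := fun J hJ x =>
    norm_mean_le hJ hb _ fun i => hlB i _
  set V := B ^ 2 * (((m : ℝ) - b) / (b * ((m : ℝ) - 1))) with hVdef
  have hV0 : 0 ≤ V :=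
    mul_nonneg (sq_nonneg _) (div_nonneg (by linarith) (mul_nonneg (by linarith) (by linarith)))
  have hV : ∀ (n : ℕ) (y : H), ∫ J, ‖∇ (empiricalRisk l) (galerkinProj f N y) -
      batchGradient l b J (galerkinProj f N y)‖ ^ 2 ∂P.map (I n) ≤ V := fun n y => by
    rw [integral_map_batch hn hbm, gradient_empiricalRisk hl]
    exact sum_powersetCard_norm_mean_sub_sq_le hm hb hbm _ fun i => hlB i _
  have hmain := abs_integral_langevinChain_sub_le (f := f) (N := N) hn hbm hanti hμ hlam hη hs hs2'
    hτ hμτ hsum hB hM hw hwB hW hWB hV0 hV ((norm_galerkinProj_le x₀).trans hx₀) n hK hφ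
    (hX.trans (galerkinGLD_eq_langevinChain μ lam β η l x₀ ε I n))
    (hY.trans (galerkinSGLD_eq_langevinChain μ lam β η b l x₀ ε I n))
  refine ⟨hmain.1, hmain.2.1, hmain.2.2.trans ?_⟩
  -- Here `(η / s) ^ 2 / 2 = β * η / 4`, the source of the factor `(B / 2) ^ 2`.
  have hr : n * ((η / s) ^ 2 / 2 * V) = (B / 2) ^ 2 * discrepancyRate n m b β η := by
    have : (b : ℝ) ≠ 0 := by linarith
    have : (m : ℝ) - 1 ≠ 0 := by linarith
    rw [div_pow, hs2, hVdef, discrepancyRate]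
    field_simp
  have hcomp : 0 ≤ comparisonConst (1 + B * μ 0 / lam) (lam / (4 * ∑' k, τ k)) := by
    have h1 := laplaceConst_nonneg (1 + B * μ 0 / lam) (lam / (4 * ∑' k, τ k))
    have h2 := hμ 0
    unfold comparisonConst
    positivity
  rw [hr, Real.sqrt_mul (sq_nonneg _), Real.sqrt_sq (by positivity), mul_assoc]
  gcongr
  linarith

end Main

end SGLD

/-! ### The three classes of test functions. -/

theorem mainTheorem7
    {H : Type*} [NormedAddCommGroup H] [InnerProductSpace ℝ H] [CompleteSpace H]
    (f : HilbertBasis ℕ ℝ H) (μ : ℕ → ℝ) (hμ : SGLD.EigenvalueDecay μ)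
    (lam : ℝ) (hlam : 0 < lam)
    (M B : ℝ) (α Cα : ℝ) (hα : α ∈ Set.Ioo (1 / 4 : ℝ) 1) (hCα : 0 < Cα)
    (α' Cα' : ℝ) (hα' : α' ∈ Set.Ico (0 : ℝ) 1) (hCα' : 0 < Cα') :
    ∃ C : ℝ, 0 < C ∧ ∃ η₀ : ℝ, 0 < η₀ ∧
      ∀ (m b : ℕ), 2 ≤ m → 1 ≤ b → b ≤ m →
      ∀ l : Fin m → H → ℝ,
        (∀ i, SGLD.IsSmoothWith M (l i)) →
        (∀ i, SGLD.HasBoundedGradient B (l i)) →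
        (∀ i, SGLD.SecondDerivBound f μ α Cα (l i)) →
        (∀ i, SGLD.ThirdDerivBound f μ α' Cα' (l i)) →
      ∀ x₀ : H, ‖x₀‖ ≤ 1 →
      ∀ (n N : ℕ) (β η : ℝ), 1 < β → 0 < η → η < η₀ →
      ∀ {Ω : Type*} [MeasurableSpace Ω] (P : Measure Ω) [IsProbabilityMeasure P]
        (ε : ℕ → ℕ → Ω → ℝ) (I : ℕ → Ω → Finset (Fin m)), SGLD.IsNoise P b ε I →
      ∀ X Y : Ω → H, X = SGLD.galerkinGLD f μ lam β η N l x₀ ε n →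
        Y = SGLD.galerkinSGLD f μ lam β η N b l x₀ ε I n →
      ∀ r : ℝ, r = SGLD.discrepancyRate n m b β η →
        -- bounded `C²` test functions with bounded derivatives
        (∀ φ : H → ℝ, SGLD.IsCb2 φ →
          Integrable (fun ω => φ (X ω)) P ∧ Integrable (fun ω => φ (Y ω)) P ∧
          |∫ ω, (φ (X ω) - φ (Y ω)) ∂P| ≤
            C * SGLD.cb2Norm φ * (Real.sqrt r + r ^ (1 / 4 : ℝ))) ∧
        -- the test function `φ = σ(L - L(x*))` for a global minimizer `x*` of `L`
        (∀ xstar : H, (∀ y, SGLD.empiricalRisk l xstar ≤ SGLD.empiricalRisk l y) →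
          ∀ φ : H → ℝ, φ = (fun x => SGLD.sigmoidShifted
              (SGLD.empiricalRisk l x - SGLD.empiricalRisk l xstar)) →
          Integrable (fun ω => φ (X ω)) P ∧ Integrable (fun ω => φ (Y ω)) P ∧
          |∫ ω, (φ (X ω) - φ (Y ω)) ∂P| ≤ C * (Real.sqrt r + r ^ (1 / 4 : ℝ))) ∧
        -- the objective `L` itself
        (Integrable (fun ω => SGLD.empiricalRisk l (X ω)) P ∧
          Integrable (fun ω => SGLD.empiricalRisk l (Y ω)) P ∧
          |∫ ω, (SGLD.empiricalRisk l (X ω) - SGLD.empiricalRisk l (Y ω)) ∂P| ≤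
            C * (Real.sqrt r + r ^ (1 / 4 : ℝ))) := by
  obtain ⟨τ, hτ, hμτ, hsum⟩ := hμ.exists_summable_majorant
  set D := SGLD.comparisonConst (1 + |B| * μ 0 / lam) (lam / (4 * ∑' k, τ k)) * |B| with hD
  have hD0 : 0 ≤ D := by
    have h1 := SGLD.laplaceConst_nonneg (1 + |B| * μ 0 / lam) (lam / (4 * ∑' k, τ k))
    have h2 := hμ.2.1 0
    rw [hD]
    unfold SGLD.comparisonConst
    positivity
  -- `D` serves the `C²` test functions, `|B| * D` the two built from the `|B|`-Lipschitz risk, and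
  -- `+ 1` ensures positivity. Any positive `η₀` would do.
  refine ⟨(1 + |B|) * D + 1, by positivity, 1, one_pos, ?_⟩
  intro m b hm hb hbm l hsm hbd _ _ x₀ hx₀ n N β η hβ hη _ Ω _ P _ ε I hn X Y hX hY r hr
  have hl : ∀ i, Differentiable ℝ (l i) := fun i => (hsm i).1
  have hlM : ∀ i x y, ‖∇ (l i) x - ∇ (l i) y‖ ≤ |M| * ‖x - y‖ := fun i x y =>
    ((hsm i).2 x y).trans (mul_le_mul_of_nonneg_right (le_abs_self M) (norm_nonneg _))
  have hlB : ∀ i x, ‖∇ (l i) x‖ ≤ |B| := fun i x => (hbd i x).trans (le_abs_self B)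
  have hr4 : 0 ≤ r ^ (1 / 4 : ℝ) := by
    have hβ0 : 0 < β := one_pos.trans hβ
    have hm2 : (2 : ℝ) ≤ m := by exact_mod_cast hm
    have hbm' : (b : ℝ) ≤ m := by exact_mod_cast hbm
    refine Real.rpow_nonneg ?_ _
    rw [hr, SGLD.discrepancyRate]
    exact div_nonneg (mul_nonneg (by positivity) (by linarith))
      (mul_nonneg (by positivity) (by linarith))
  have key : ∀ (K : ℝ) (φ : H → ℝ), 0 ≤ K → (∀ x y, |φ x - φ y| ≤ K * ‖x - y‖) →
      MeasureTheory.Integrable (fun ω => φ (X ω)) P ∧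
        MeasureTheory.Integrable (fun ω => φ (Y ω)) P ∧
        |∫ ω, (φ (X ω) - φ (Y ω)) ∂P| ≤ K * D * (Real.sqrt r + r ^ (1 / 4 : ℝ)) := by
    intro K φ hK hφ
    have h := SGLD.abs_integral_galerkinGLD_sub_galerkinSGLD_le f hμ.1 hμ.2.1 hlam hτ hμτ hsum
      (abs_nonneg M) (abs_nonneg B) hm hb hbm hl hlM hlB hx₀ n N hβ hη hn hK hφ hX hY
    refine ⟨h.1, h.2.1, h.2.2.trans ?_⟩
    rw [← hr, ← hD, ← mul_assoc]
    exact mul_le_mul_of_nonneg_left (by linarith) (by positivity)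
  have hs4 : 0 ≤ Real.sqrt r + r ^ (1 / 4 : ℝ) := add_nonneg (Real.sqrt_nonneg _) hr4
  have hLB : ∀ x y, |SGLD.empiricalRisk l x - SGLD.empiricalRisk l y| ≤ |B| * ‖x - y‖ := by
    refine SGLD.abs_sub_le_of_norm_gradient_le
      (fun x => (SGLD.hasGradientAt_empiricalRisk hl x).differentiableAt) fun x => ?_
    rw [SGLD.gradient_empiricalRisk hl]
    exact SGLD.norm_mean_le (by simp) (by omega) _ fun i => hlB i _
  refine ⟨fun φ hφ => ?_, fun xstar _ φ hφ => ?_, ?_⟩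
  · have hK : 0 ≤ SGLD.cb2Norm φ := (norm_nonneg _).trans (SGLD.norm_gradient_le_cb2Norm hφ 0)
    have h := key _ φ hK (SGLD.abs_sub_le_of_norm_gradient_le (hφ.1.differentiable two_ne_zero)
      (SGLD.norm_gradient_le_cb2Norm hφ))
    refine ⟨h.1, h.2.1, h.2.2.trans (mul_le_mul_of_nonneg_right ?_ hs4)⟩
    rw [mul_comm]
    refine mul_le_mul_of_nonneg_right ?_ hK
    nlinarith [abs_nonneg B, mul_nonneg (abs_nonneg B) hD0]
  · subst hφ
    have h := key |B| (fun x => SGLD.sigmoidShifted (SGLD.empiricalRisk l x -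
      SGLD.empiricalRisk l xstar)) (abs_nonneg B) fun x y =>
      (SGLD.abs_sigmoidShifted_sub_le _ _).trans (by
        rw [sub_sub_sub_cancel_right]
        exact hLB x y)
    refine ⟨h.1, h.2.1, h.2.2.trans (mul_le_mul_of_nonneg_right ?_ hs4)⟩
    linarith
  · have h := key |B| _ (abs_nonneg B) hLB
    refine ⟨h.1, h.2.1, h.2.2.trans (mul_le_mul_of_nonneg_right ?_ hs4)⟩
    linarith
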